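/- **Notation.** For a graph $G$ and nonempty vertex sets $A,B$ let $d_G(A,B)=e_G(A,B)/(|A||B|)$, where $e_G(A,B)$ is the number of ordered pairs $(a,b)\in A\times B$ with $ab\in E(G)$. The pair $(A,B)$ is $\epsilon$-regular if $|d_G(A,B)-d_G(A',B')|\le\epsilon$ for all $A'\subseteq A$, $B'\subseteq B$ with $|A'|\ge\epsilon|A|$, $|B'|\ge\epsilon|B|$. A partition $\mathcal Z$ of $V(G)$ is perfectly $\epsilon$-regular if all pairs of distinct parts of $\mathcal Z$ are $\epsilon$-regular. A graph $G'$ on $V(G)$ is $\delta$-close to $G$ if $|E(G)\,\triangle\,E(G')|\le\delta|E(G)|$. For partitions, $\mathcal Q\preceq\mathcal P$ means that each part of $\mathcal Q$ is contained in a part of $\mathcal P$. For partitions $\mathcal Q,\mathcal P$ of the same $n$-element set, $\mathcal Q\preceq_\beta\mathcal P$ means that the parts $Q\in\mathcal Q$ for which no $P\in\mathcal P$ satisfies $|Q\setminus P|\le\beta|Q|$ have total size at most $\beta n$. **Sequences of bipartitions.** Let $n$ be even. An $(n,d,\alpha,\beta)$-sequence on a set $X$ with $|X|=n$ is a sequence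 of $d$ bipartitions $(X_{i,0},X_{i,1})$ of $X$ with $|X_{i,0}|=|X_{i,1}|=n/2$ such that $|X_{i,\ell}\cap X_{j,\ell'}|\le(\frac14+\alpha)n$ for all $i\ne j$ and $\ell,\ell'\in\{0,1\}$, and such that for all $x\ne y$ in $X$ at most $(\frac12+\beta)d$ of the bipartitions have $x$ and $y$ on the same side. **Modified blow-up.** Let $G$ be a $d$-regular graph. $G(n,d,\alpha,\beta)$ denotes any graph obtained as follows. Replace each vertex $x$ of $G$ by a set $X$ of $n$ new vertices. For each $x$, associate with each neighbour $y$ of $x$ (replaced by $Y$) a bipartition $(X_{Y,0},X_{Y,1})$ of $X$, so that these $d$ bipartitions form an $(n,d,\alpha,\beta)$-sequence. For each edge $xy$ of $G$, either join $X_{Y,\ell}$ completely to $Y_{X,\ell}$ for both $\ell\in\{0,1\}$, or join $X_{Y,\ell}$ completely to $Y_{X,1-\ell}$ for both $\ell\in\{0,1\}$ (the choice may depend on the edge). There are no other edges. **Construction.** Let $s\ge400$ be an even integer and put $p=2^{-s}$, $n_0=4^{s+8}$, $n_r=2^{\lfloor n_{r-1}/200\rfloor}$, $\alpha_r=1/(8n_0\cdots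 n_{r-1})$ and $d_{r-1}=n_0\prod_{j=1}^{r-1}(n_j/2)$ for $1\le r\le s$. Let $G_0=K_{n_0,n_0}$, for $1\le r\le s$ let $G_r$ be any graph of the form $G_{r-1}(n_r,d_{r-1},\alpha_r,\frac1{16})$, and let $G_s^\circ$ be any blow-up of $G_s$ (for some $m\ge1$ each vertex is replaced by $m$ vertices and each edge by a copy of $K_{m,m}$). For $0\le r\le s$ let $\mathcal X_r$ be the partition of $V(G_s^\circ)$ whose parts correspond to the vertices of $G_r$: two vertices are in the same part if and only if they stem from the same vertex of $G_r$. **Theorem.** Let $\delta\le2^{-32}$ and put $\gamma=\max\{64\sqrt\delta,\,p^{1/7}\}$. Let $\mathcal Z\preceq\mathcal X_0$ be a perfectly $\frac1{16}p$-regular partition of a graph that is $\delta$-close to $G_s^\circ$. Then $\mathcal Z\preceq_\gamma\mathcal X_s$. -/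

import Mathlib

namespace SRAL

/-! ### Regular pairs, close graphs and approximate refinements -/

section Graphs

variable {W : Type*}

/-- `G'` is `δ`-close to `G`: it arises from `G` by adding and/or removing at most `δ |E(G)|`
edges. -/
def IsClose (δ : ℝ) (G G' : SimpleGraph W) : Prop :=
  ((symmDiff G.edgeSet G'.edgeSet).ncard : ℝ) ≤ δ * (G.edgeSet.ncard : ℝ)

open Classical in
/-- The pair `(A, B)` is `ε`-regular in `G` (with a non-strict inequality between densities). -/
def IsRegularPair (G : SimpleGraph W) (ε : ℝ) (A B : Finset W) : Prop :=
  ∀ A' ⊆ A, ∀ B' ⊆ B, ε * (A.card : ℝ) ≤ (A'.card : ℝ) → ε * (B.card : ℝ) ≤ (B'.card : ℝ) →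
    |(G.edgeDensity A B : ℝ) - (G.edgeDensity A' B' : ℝ)| ≤ ε

variable [Fintype W] [DecidableEq W]

/-- All pairs of distinct parts of `Z` are `ε`-regular. -/
def IsPerfectlyRegular (G : SimpleGraph W) (ε : ℝ)
    (Z : Finpartition (Finset.univ : Finset W)) : Prop :=
  ∀ A ∈ Z.parts, ∀ B ∈ Z.parts, A ≠ B → IsRegularPair G ε A B

/-- `S ⊆_β T`: all but a `β`-fraction of `S` is contained in `T`. -/
def ApproxSubset (β : ℝ) (S T : Finset W) : Prop :=
  ((S \ T).card : ℝ) ≤ β * (S.card : ℝ)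

/-- `S ∈_β P`: the set `S` is `β`-contained in some part of `P`. -/
def ApproxMem (β : ℝ) (S : Finset W) (P : Finpartition (Finset.univ : Finset W)) : Prop :=
  ∃ T ∈ P.parts, ApproxSubset β S T

open Classical in
/-- `Q ≼_β P`: the parts of `Q` that are not `β`-contained in a part of `P` cover at most a
`β`-fraction of all vertices. -/
def ApproxRefines (β : ℝ) (Q P : Finpartition (Finset.univ : Finset W)) : Prop :=
  ∑ S ∈ Q.parts with ¬ ApproxMem β S P, (S.card : ℝ) ≤ β * (Fintype.card W : ℝ)

end Graphs

/-! ### Sequences of bipartitions -/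

/-- A family `b` of (labelled) bipartitions of `X`, indexed by `ι`: the `i`-th bipartition is
`(X_{i,0}, X_{i,1})` where `X_{i,ℓ} = {x | b i x = ℓ}`. It is an `(n, d, α, β)`-sequence if
`|X| = n` is even, there are `d` bipartitions, each is equitable, the family is `α`-orthogonal
and it is `β`-balanced. -/
structure IsBipartitionSequence {ι X : Type*} (b : ι → X → Bool) (n d : ℕ) (α β : ℝ) : Prop where
  card_ground : Nat.card X = n
  even_card : Even n
  card_index : Nat.card ι = d
  equitable : ∀ i, ∀ l : Bool, 2 * {x | b i x = l}.ncard = n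
  orthogonal : ∀ i j, i ≠ j → ∀ l l' : Bool,
    ({x | b i x = l ∧ b j x = l'}.ncard : ℝ) ≤ (1 / 4 + α) * (n : ℝ)
  balanced : ∀ x y, x ≠ y → ({i | b i x = b i y}.ncard : ℝ) ≤ (1 / 2 + β) * (d : ℝ)

/-! ### Blow-ups and modified blow-ups -/

/-- The blow-up of `G` in which every vertex is replaced by `m` vertices and every edge by a
complete bipartite graph. -/
def blowup {V : Type*} (G : SimpleGraph V) (m : ℕ) : SimpleGraph (V × Fin m) :=
  G.comap Prod.fst

/-- `H` is a modified blow-up `G(n, d, α, β)`. A vertex `x` of `G` is replaced by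
`X = {x} × Fin n`. For a neighbour `y` of `x`, the bipartition of `X` associated with `Y` is
`X_{Y,ℓ} = {(x, i) | side x y i = ℓ}`, and for each `x` these bipartitions form an
`(n, d, α, β)`-sequence. For an edge `e = {x, y}` of `G`, if `swap e = false` then `X_{Y,ℓ}` is
completely joined to `Y_{X,ℓ}` for both `ℓ`, and if `swap e = true` then `X_{Y,ℓ}` is completely
joined to `Y_{X,1-ℓ}` for both `ℓ`; there are no other edges. -/
def IsModifiedBlowup {V : Type*} (G : SimpleGraph V) (n d : ℕ) (α β : ℝ)
    (H : SimpleGraph (V × Fin n)) : Prop :=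
  ∃ (side : V → V → Fin n → Bool) (swap : Sym2 V → Bool),
    (∀ x, IsBipartitionSequence (fun y : G.neighborSet x => side x y) n d α β) ∧
    ∀ u v : V × Fin n, H.Adj u v ↔
      G.Adj u.1 v.1 ∧ (side u.1 v.1 u.2 ^^ side v.1 u.1 v.2) = swap s(u.1, v.1)

/-! ### The construction -/

/-- `n_0 = 4^(s+8)` and `n_r = 2^⌊n_{r-1}/200⌋`. -/
def blowupSize (s : ℕ) : ℕ → ℕ
  | 0 => 4 ^ (s + 8)
  | r + 1 => 2 ^ (blowupSize s r / 200)

/-- `d_r = n_0 ∏_{j=1}^{r} (n_j / 2)`. -/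
def degree (s r : ℕ) : ℕ :=
  blowupSize s 0 * ∏ j ∈ Finset.Icc 1 r, blowupSize s j / 2

/-- `α_r = 1 / (8 n_0 ⋯ n_{r-1})`. -/
noncomputable def orth (s r : ℕ) : ℝ :=
  1 / (8 * ∏ j ∈ Finset.range r, (blowupSize s j : ℝ))

/-- `p = 2^{-s}`. -/
noncomputable def density (s : ℕ) : ℝ := 1 / 2 ^ s

/-- The vertex set of `G_r`: two classes of size `n_0` for `r = 0`, and each vertex of `G_r` is
replaced by `n_{r+1}` vertices of `G_{r+1}`. -/
def Vertex (s : ℕ) : ℕ → Type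
  | 0 => Fin (blowupSize s 0) ⊕ Fin (blowupSize s 0)
  | r + 1 => Vertex s r × Fin (blowupSize s (r + 1))

instance instFintypeVertex (s : ℕ) : (r : ℕ) → Fintype (Vertex s r)
  | 0 => inferInstanceAs (Fintype (Fin (blowupSize s 0) ⊕ Fin (blowupSize s 0)))
  | r + 1 =>
    letI := instFintypeVertex s r
    inferInstanceAs (Fintype (Vertex s r × Fin (blowupSize s (r + 1))))

instance instDecidableEqVertex (s : ℕ) : (r : ℕ) → DecidableEq (Vertex s r)
  | 0 => inferInstanceAs (DecidableEq (Fin (blowupSize s 0) ⊕ Fin (blowupSize s 0)))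
  | r + 1 =>
    letI := instDecidableEqVertex s r
    inferInstanceAs (DecidableEq (Vertex s r × Fin (blowupSize s (r + 1))))

/-- `G_0, …, G_s` is a run of the construction with parameter `s`: `G_0 = K_{n_0,n_0}`, and
`G_{r+1}` is a modified blow-up `G_r(n_{r+1}, d_r, α_{r+1}, 1/16)` for every `r < s`.
(Only `G r` with `r ≤ s` matters.) -/
structure IsConstruction (s : ℕ) (G : ∀ r, SimpleGraph (Vertex s r)) : Prop where
  zero : G 0 = completeBipartiteGraph (Fin (blowupSize s 0)) (Fin (blowupSize s 0))
  succ : ∀ r < s, IsModifiedBlowup (G r) (blowupSize s (r + 1)) (degree s r)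
    (orth s (r + 1)) (1 / 16) (G (r + 1))

/-- Two vertices of `G_k` are equivalent at level `r` if they stem from the same vertex of `G_r`
(for `k ≤ r`: if they are equal). -/
def levelSetoid (s r : ℕ) : (k : ℕ) → Setoid (Vertex s k)
  | 0 => ⊥
  | k + 1 => if k < r then ⊥ else (levelSetoid s r k).comap Prod.fst

open Classical in
/-- The partition `X_r` of the vertex set of the `m`-fold blow-up of `G_s`: its parts are the sets
of vertices stemming from a common vertex of `G_r`. -/
noncomputable def levelPartition (s m r : ℕ) :
    Finpartition (Finset.univ : Finset (Vertex s s × Fin m)) :=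
  Finpartition.ofSetoid ((levelSetoid s r s).comap Prod.fst)

end SRAL

open SRAL

/-!
The graph `blowup (G s) m` is bipartite with classes of size `N`, is regular of degree `D = p N`,
and carries a chain of finer and finer partitions, one for each level `r ≤ s`. The facts about it
that matter are collected in the structure `BlowupTower`, and `IsConstruction.exists_blowupTower`
verifies them: equitability gives the degrees, balancedness says that two vertices which are
separated exactly after level `r` lie on different sides for at least `7/16` of their neighbours
(counted at level `s`), and orthogonality bounds the codegree of two vertices in different parts
of level `0` by `2 p D`.

Call a part `P` of `Z` *concentrated* at level `R` if all but a `γ`-fraction of it lies in one class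
of level `R`. By induction on `R`, the non-concentrated parts cover at most a `γ`-fraction of the
vertices. Suppose this fails for the first time at level `R + 1`. If `P` is not concentrated there,
then each `a ∈ P` is separated by level `R + 1` from more than `γ |P|` elements `b ∈ P`; let `σ a`
be the exact proportion. Consider a separated pair `(a, b)`, the last level `r = lev a b` at which
they are together, and the at least `7/16 D` neighbours `t` of `a` that lie across from `b`. The triples
`(a, b, t)` split into boxes `A × B × C` (`BlowupTower.sum_bigTriples_le`): `A` and `B` are the two
sides, with respect to the class of `t`, of the piece of `P` in a class of level `r`, and `C` is
made of the vertices in the part and class of `t` which are joined to the side `A`. In the original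
graph there are no edges between `B` and `C`, so that regularity of `G'` forces the density between
`A` and `C` to be at most `p / 8`, up to the edges that were edited. Triples in which
`A` or `B` is too small for regularity are negligible in number, those in which `C` is too small
contribute at most `D / 8` for each pair provided that `t` lies in the class of level `R` at which
its part is concentrated. The result is `BlowupTower.part_bound`. The remaining `t` form an
exceptional set `S` with `|S| ≤ 4 γ N`, and by the codegree bound a set this small contains few of
the neighbours, on average with respect to the weight `σ` (`BlowupTower.sq_sum_mul_card_le`).

Altogether `D / 32 · ∑ σ` is at most twice the number of edited ordered pairs, hence at most
`4 δ N D`; on the other hand `∑ σ > 2 γ² N`, which contradicts `γ² ≥ 64 δ`. As the levels at which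
different `b` are separated from `a` are counted together, no factor `s` is lost.
-/

namespace SRAL

/-! ### Towers of blow-ups -/

section Tower

open Finset
open scoped Classical

/-- A graph (`adj s`) on `W` with a chain of finer and finer equivalence relations, as produced by
iterating modified blow-ups. Here `cls r` relates the vertices with the same ancestor at level `r`,
and `adj r` is adjacency of the ancestors at level `r`. For `r < s`, `side r a t` is the side of the
ancestor of `a` at level `r + 1` in the bipartition given by the ancestor of `t` at level `r`.
The vertex set consists of two halves of size `N`, and the graph is `D`-regular with density `p`
between them. Only levels up to `s` are constrained. -/
structure BlowupTower (W : Type*) [Fintype W] (s : ℕ) (p N D : ℝ) where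
  cls : ℕ → Setoid W
  adj : ℕ → W → W → Prop
  side : ℕ → W → W → Bool
  cls_of_succ : ∀ r < s, ∀ a b, cls (r + 1) a b → cls r a b
  adj_of_succ : ∀ r < s, ∀ a t, adj (r + 1) a t → adj r a t
  not_adj_zero : ∀ a t, cls 0 a t → ¬ adj 0 a t
  side_congr : ∀ r < s, ∀ a a' t t', cls (r + 1) a a' → cls r t t' → side r a t = side r a' t'
  /-- Adjacency at level `r + 1` from vertices of one class of level `r` to `t` is decided by the
  side with respect to the class of `t`. -/
  adj_succ_iff : ∀ r < s, ∀ a b t, cls r a b → adj (r + 1) a t →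
    (adj (r + 1) b t ↔ side r a t = side r b t)
  card_univ : (Fintype.card W : ℝ) = 2 * N
  D_eq : D = p * N
  card_cls_zero : ∀ a, (#{b | cls 0 a b} : ℝ) ≤ p ^ 2 * N
  card_adj_zero : ∀ a, (#{t | adj 0 a t} : ℝ) ≤ N
  card_adj : ∀ a, (#{t | adj s a t} : ℝ) = D
  /-- Two vertices in the same class of level `r` have equally many neighbours in each class of
  level `r`, stated for unions of such classes. -/
  card_adj_and : ∀ r < s, ∀ a b, cls r a b → ∀ φ : W → Prop,
    (∀ t t', cls r t t' → (φ t ↔ φ t')) →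
    #{t | adj s a t ∧ φ t} = #{t | adj s b t ∧ φ t}
  /-- Two vertices that separate just after level `r` are on the same side for at most `9/16` of the
  neighbours. -/
  card_side_eq : ∀ r < s, ∀ a b, cls r a b → ¬ cls (r + 1) a b →
    (#{t | adj s a t ∧ side r a t = side r b t} : ℝ) ≤ 9 / 16 * D
  codegree : ∀ a b, ¬ cls 0 a b → (#{t | adj s a t ∧ adj s b t} : ℝ) ≤ 2 * p * D

/-- Regularity on a box: the densities of `(A, C)` and `(B, C)` differ by at most `2 ε`, written as
a sum over `A × B × C`. -/
lemma IsRegularPair.sum_sub_le {W : Type*} {G' : SimpleGraph W} {ε : ℝ} {P Q A B C : Finset W}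
    (h : IsRegularPair G' ε P Q) (hA : A ⊆ P) (hB : B ⊆ P) (hC : C ⊆ Q)
    (hA' : ε * (#P : ℝ) ≤ #A) (hB' : ε * (#P : ℝ) ≤ #B) (hC' : ε * (#Q : ℝ) ≤ #C) :
    ∑ a ∈ A, ∑ b ∈ B, ∑ t ∈ C, ((if G'.Adj a t then (1 : ℝ) else 0) -
      (if G'.Adj b t then 1 else 0) - 2 * ε) ≤ 0 := by
  have key : ∀ X : Finset W, ∑ a ∈ X, ∑ t ∈ C, (if G'.Adj a t then (1 : ℝ) else 0)
      = (G'.edgeDensity X C : ℝ) * (#X * #C) := by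
    intro X
    rw [SimpleGraph.edgeDensity_def, SimpleGraph.interedges, Rel.interedges, card_filter,
      sum_product]
    push_cast
    rcases eq_or_ne (#X : ℝ) 0 with h0 | h0
    · have : X = ∅ := by simpa using h0
      simp [this]
    rcases eq_or_ne (#C : ℝ) 0 with h1 | h1
    · have : C = ∅ := by simpa using h1
      simp [this]
    field_simp
    refine sum_congr rfl fun a _ => sum_congr rfl fun t _ => ?_
    split_ifs <;> simp
  have h1 := abs_le.1 (h A hA C hC hA' hC')
  have h2 := abs_le.1 (h B hB C hC hB' hC')
  have e1 : ∑ a ∈ A, ∑ b ∈ B, ∑ t ∈ C, ((if G'.Adj a t then (1 : ℝ) else 0) -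
      (if G'.Adj b t then 1 else 0) - 2 * ε) =
      ((G'.edgeDensity A C : ℝ) - G'.edgeDensity B C - 2 * ε) * (#A * #B * #C) := by
    simp only [sum_sub_distrib, sum_const, nsmul_eq_mul]
    rw [← mul_sum, key A, key B]
    ring
  rw [e1]
  apply mul_nonpos_of_nonpos_of_nonneg
  · linarith [h1.1, h2.2]
  · positivity

namespace BlowupTower

variable {W : Type*} [Fintype W] {s : ℕ} {p N D : ℝ} (T : BlowupTower W s p N D)

lemma cls_antitone {i j : ℕ} (hij : i ≤ j) (hj : j ≤ s) {a b : W} (h : T.cls j a b) :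
    T.cls i a b := by
  induction hij with
  | refl => exact h
  | step _ ih => exact ih (by omega) (T.cls_of_succ _ (by omega) _ _ h)

lemma adj_antitone {i j : ℕ} (hij : i ≤ j) (hj : j ≤ s) {a b : W} (h : T.adj j a b) :
    T.adj i a b := by
  induction hij with
  | refl => exact h
  | step _ ih => exact ih (by omega) (T.adj_of_succ _ (by omega) _ _ h)

/-- The last level at which `a` and `b` are in the same class, provided that they are in the same
class at level `0` and in different classes at some level up to `s`. -/
noncomputable def lev (a b : W) : ℕ := sInf {r | ¬ T.cls (r + 1) a b}

lemma lev_comm (a b : W) : T.lev a b = T.lev b a := by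
  simp only [lev, (T.cls _).comm (x := a)]

lemma lev_spec {R : ℕ} {a b : W} (h0 : T.cls 0 a b) (h : ¬ T.cls (R + 1) a b) :
    T.lev a b ≤ R ∧ T.cls (T.lev a b) a b ∧ ¬ T.cls (T.lev a b + 1) a b := by
  have h1 : T.lev a b ∈ {r | ¬ T.cls (r + 1) a b} := Nat.sInf_mem ⟨R, h⟩
  refine ⟨Nat.sInf_le h, ?_, h1⟩
  rcases hl : T.lev a b with _ | r
  · exact h0
  · by_contra h2
    have : T.lev a b ≤ r := Nat.sInf_le h2
    omega

lemma lev_eq {r : ℕ} (hr : r < s) {a b : W} (h : T.cls r a b) (h' : ¬ T.cls (r + 1) a b) :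
    T.lev a b = r := by
  have h0 := T.cls_antitone (Nat.zero_le r) hr.le h
  obtain ⟨h1, -, h3⟩ := T.lev_spec h0 h'
  by_contra hne
  exact h3 (T.cls_antitone (by omega) hr.le h)

/-- The vertices of `P` in the level-`r` class of `a` that lie on the same side as `a` with respect
to the class of `t`. -/
noncomputable def sameSide (P : Finset W) (r : ℕ) (a t : W) : Finset W :=
  {x ∈ P | T.cls r x a ∧ T.side r x t = T.side r a t}

/-- The vertices of `P` in the level-`r` class of `a` that lie on the opposite side from `a` with
respect to the class of `t`. -/
noncomputable def oppSide (P : Finset W) (r : ℕ) (a t : W) : Finset W :=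
  {x ∈ P | T.cls r x a ∧ T.side r x t ≠ T.side r a t}

lemma side_congr_right {r : ℕ} (hr : r < s) (a : W) {t t' : W} (h : T.cls r t t') :
    T.side r a t = T.side r a t' := T.side_congr r hr a a t t' ((T.cls _).refl a) h

lemma sameSide_congr {P : Finset W} {r : ℕ} (hr : r < s) {a x t u : W} (hx : T.cls r x a)
    (hxt : T.side r x t = T.side r a t) (hu : T.cls r u t) :
    T.sameSide P r x u = T.sameSide P r a t := by
  ext y
  simp only [sameSide, mem_filter, T.side_congr_right hr _ hu, hxt]
  exact and_congr_right fun _ => and_congr_left fun _ =>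
    ⟨fun h => (T.cls r).trans h hx, fun h => (T.cls r).trans h ((T.cls r).symm hx)⟩

lemma oppSide_congr {P : Finset W} {r : ℕ} (hr : r < s) {a x t u : W} (hx : T.cls r x a)
    (hxt : T.side r x t = T.side r a t) (hu : T.cls r u t) :
    T.oppSide P r x u = T.oppSide P r a t := by
  ext y
  simp only [oppSide, mem_filter, T.side_congr_right hr _ hu, hxt]
  exact and_congr_right fun _ => and_congr_left fun _ =>
    ⟨fun h => (T.cls r).trans h hx, fun h => (T.cls r).trans h ((T.cls r).symm hx)⟩

lemma sameSide_eq_oppSide {P : Finset W} {r : ℕ} {a b t : W} (hab : T.cls r a b)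
    (h : T.side r a t ≠ T.side r b t) : T.sameSide P r a t = T.oppSide P r b t := by
  ext y
  simp only [sameSide, oppSide, mem_filter]
  refine and_congr_right fun _ => and_congr
    ⟨fun h => (T.cls r).trans h hab, fun h => (T.cls r).trans h ((T.cls r).symm hab)⟩ ?_
  revert h
  cases T.side r y t <;> cases T.side r a t <;> cases T.side r b t <;> simp

lemma adj_succ_congr {r : ℕ} (hr : r < s) {a x u : W} (hx : T.cls r x a)
    (h : T.side r x u = T.side r a u) : T.adj (r + 1) x u ↔ T.adj (r + 1) a u :=
  ⟨fun h1 => (T.adj_succ_iff r hr x a u hx h1).2 h,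
    fun h1 => (T.adj_succ_iff r hr a x u ((T.cls r).symm hx) h1).2 h.symm⟩

variable [DecidableEq W] (Z : Finpartition (univ : Finset W))

/-- The vertices in the part of `Z` and in the level-`r` class of `t` that are joined to `a` at
level `r + 1`, hence to the side of `a` and not to the opposite side. -/
noncomputable def nbrSide (r : ℕ) (a t : W) : Finset W :=
  {u ∈ Z.part t | T.cls r u t ∧ T.adj (r + 1) a u}

lemma nbrSide_congr {r : ℕ} (hr : r < s) {a x t u : W} (hx : T.cls r x a)
    (hxt : T.side r x t = T.side r a t) (hu : T.cls r u t) (hpart : Z.part u = Z.part t) :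
    T.nbrSide Z r x u = T.nbrSide Z r a t := by
  ext y
  simp only [nbrSide, mem_filter, hpart]
  refine and_congr_right fun _ => ?_
  have e : T.cls r y u ↔ T.cls r y t :=
    ⟨fun h => (T.cls r).trans h hu, fun h => (T.cls r).trans h ((T.cls r).symm hu)⟩
  rw [e]
  refine and_congr_right fun h => T.adj_succ_congr hr hx ?_
  rw [T.side_congr_right hr _ h, hxt, T.side_congr_right hr _ h]

/-- The triples `(a, b, t)` with `a, b ∈ P` separated by level `R + 1` and `t` joined to the side of
`a` and not to that of `b`, at the level where `a` and `b` separate, such that the three sets to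
which regularity is applied are large enough. -/
noncomputable def bigTriples (ε : ℝ) (R : ℕ) (P : Finset W) : Finset (W × W × W) :=
  {x | x.1 ∈ P ∧ x.2.1 ∈ P ∧ ¬ T.cls (R + 1) x.1 x.2.1 ∧
    T.adj (T.lev x.1 x.2.1 + 1) x.1 x.2.2 ∧
    T.side (T.lev x.1 x.2.1) x.1 x.2.2 ≠ T.side (T.lev x.1 x.2.1) x.2.1 x.2.2 ∧
    ε * #P ≤ #(T.sameSide P (T.lev x.1 x.2.1) x.1 x.2.2) ∧
    ε * #P ≤ #(T.oppSide P (T.lev x.1 x.2.1) x.1 x.2.2) ∧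
    ε * #(Z.part x.2.2) ≤ #(T.nbrSide Z (T.lev x.1 x.2.1) x.1 x.2.2)}

/-- The triples in `bigTriples` are a disjoint union of boxes, namely the fibres of the map which
sends `(a, b, t)` to the triple of sets `sameSide`, `oppSide`, `nbrSide`. On each box regularity
of `G'` applies, as adjacent vertices never lie in the same part of `Z`. -/
lemma sum_bigTriples_le {Z} {G' : SimpleGraph W} {ε : ℝ} {R : ℕ} (hR : R < s) {P : Finset W}
    (hZ : ∀ P ∈ Z.parts, ∀ a ∈ P, ∀ b ∈ P, T.cls 0 a b)
    (hreg : IsPerfectlyRegular G' ε Z) (hP : P ∈ Z.parts) :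
    ∑ x ∈ T.bigTriples Z ε R P, ((if G'.Adj x.1 x.2.2 then (1 : ℝ) else 0) -
      (if G'.Adj x.2.1 x.2.2 then 1 else 0) - 2 * ε) ≤ 0 := by
  set key : W × W × W → Finset W × Finset W × Finset W := fun x =>
    (T.sameSide P (T.lev x.1 x.2.1) x.1 x.2.2, T.oppSide P (T.lev x.1 x.2.1) x.1 x.2.2,
      T.nbrSide Z (T.lev x.1 x.2.1) x.1 x.2.2) with hkey
  rw [← sum_fiberwise_of_maps_to (g := key) (t := (T.bigTriples Z ε R P).image key)
    (fun x hx => mem_image_of_mem _ hx)]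
  refine sum_nonpos fun k hk => ?_
  obtain ⟨⟨a, b, t⟩, hx, rfl⟩ := mem_image.1 hk
  have hx' := hx
  simp only [bigTriples, mem_filter, mem_univ, true_and] at hx
  obtain ⟨ha, hb, hsep, hadj, hside, hA, hB, hC⟩ := hx
  obtain ⟨hlR, hl1, hl2⟩ := T.lev_spec (hZ P hP a ha b hb) hsep
  have hkabt : key (a, b, t) = (T.sameSide P (T.lev a b) a t, T.oppSide P (T.lev a b) a t,
    T.nbrSide Z (T.lev a b) a t) := rfl
  set r := T.lev a b with hr
  have hrs : r < s := by omega
  have hfib : {x ∈ T.bigTriples Z ε R P | key x = key (a, b, t)} =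
      T.sameSide P r a t ×ˢ T.oppSide P r a t ×ˢ T.nbrSide Z r a t := by
    ext ⟨x, y, u⟩
    simp only [mem_filter, mem_product]
    constructor
    · rintro ⟨h1, h2⟩
      simp only [bigTriples, mem_filter, mem_univ, true_and] at h1
      obtain ⟨hx, hy, hsep', hadj', hside', -⟩ := h1
      obtain ⟨-, hl1', -⟩ := T.lev_spec (hZ P hP x hx y hy) hsep'
      rw [hkabt] at h2
      simp only [hkey, Prod.mk.injEq] at h2
      obtain ⟨h2, h3, h4⟩ := h2
      rw [← h2, ← h3, ← h4]
      refine ⟨?_, ?_, ?_⟩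
      · simp only [sameSide, mem_filter]
        exact ⟨hx, (T.cls _).refl x, trivial⟩
      · simp only [oppSide, mem_filter]
        exact ⟨hy, (T.cls _).symm hl1', hside'.symm⟩
      · simp only [nbrSide, mem_filter]
        exact ⟨Z.mem_part_self.2 (mem_univ _), (T.cls _).refl u, hadj'⟩
    · rintro ⟨h1, h2, h3⟩
      simp only [sameSide, mem_filter] at h1
      simp only [oppSide, mem_filter] at h2
      simp only [nbrSide, mem_filter] at h3
      obtain ⟨hx, hxa, hxs⟩ := h1
      obtain ⟨hy, hya, hys⟩ := h2
      obtain ⟨hu, hut, hua⟩ := h3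
      have hpart : Z.part u = Z.part t :=
        Z.part_eq_of_mem (Z.part_mem.2 (mem_univ _)) hu
      have hxy : T.cls r x y := (T.cls r).trans hxa ((T.cls r).symm hya)
      have hsu : T.side r x u ≠ T.side r y u := by
        rw [T.side_congr_right hrs _ hut, T.side_congr_right hrs _ hut, hxs]
        exact hys.symm
      have hxy' : ¬ T.cls (r + 1) x y := fun h =>
        hsu (T.side_congr r hrs x y u u h ((T.cls r).refl u))
      have hlev := T.lev_eq hrs hxy hxy'
      have e1 := T.sameSide_congr (P := P) hrs hxa hxs hut
      have e2 := T.oppSide_congr (P := P) hrs hxa hxs hut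
      have e3 := T.nbrSide_congr Z hrs hxa hxs hut hpart
      refine ⟨?_, ?_⟩
      · simp only [bigTriples, mem_filter, mem_univ, true_and, hlev, e1, e2, e3, hpart]
        refine ⟨hx, hy, fun h => hxy' (T.cls_antitone (by omega) (by omega) h), ?_, hsu, hA, hB, hC⟩
        refine (T.adj_succ_congr hrs hxa ?_).2 hua
        rw [T.side_congr_right hrs _ hut, T.side_congr_right hrs _ hut, hxs]
      · simp only [hkey, hlev, e1, e2, e3]
        rfl
  rw [hfib]
  simp only [sum_product]
  have hne : P ≠ Z.part t := by
    rintro rfl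
    exact T.not_adj_zero a t (hZ _ hP a ha t (Z.mem_part_self.2 (mem_univ _)))
      (T.adj_antitone (Nat.zero_le _) (by omega) hadj)
  exact (hreg P hP _ (Z.part_mem.2 (mem_univ t)) hne).sum_sub_le (filter_subset _ _)
    (filter_subset _ _) (filter_subset _ _) hA hB hC

end BlowupTower

end Tower

/-! ### Counting separating neighbours of a part -/

section Counting

open Finset
open scoped Classical

namespace BlowupTower

variable {W : Type*} [Fintype W] {s : ℕ} {p N D : ℝ} (T : BlowupTower W s p N D)

/-- The ordered pairs of vertices of `P` in different classes of level `R + 1`. -/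
noncomputable def sepPairs (R : ℕ) (P : Finset W) : Finset (W × W) :=
  {x | x.1 ∈ P ∧ x.2 ∈ P ∧ ¬ T.cls (R + 1) x.1 x.2}

/-- The indicator of the pairs on which `G'` differs from the graph of the tower. -/
noncomputable def edit (G' : SimpleGraph W) (a t : W) : ℝ :=
  if (T.adj s a t ↔ G'.Adj a t) then 0 else 1

lemma edit_nonneg (G' : SimpleGraph W) (a t : W) : 0 ≤ T.edit G' a t := by
  unfold edit; split_ifs <;> norm_num

lemma le_card_side_ne {r : ℕ} (hr : r < s) {a b : W} (h : T.cls r a b)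
    (h' : ¬ T.cls (r + 1) a b) :
    7 / 16 * D ≤ #{t | T.adj s a t ∧ T.side r a t ≠ T.side r b t} := by
  have h1 := T.card_side_eq r hr a b h h'
  have h2 := T.card_adj a
  have h3 := card_filter_add_card_filter_not (s := ({t | T.adj s a t} : Finset W))
    (fun t => T.side r a t = T.side r b t)
  rw [filter_filter, filter_filter] at h3
  rw [← h3] at h2
  push_cast at h2
  simp only [ne_eq]
  linarith

/-- For given `a` and `t`, a vertex `b` counted here lies in one of the `R + 1` sets
`oppSide P r a t`, and that set has fewer than `ε |P|` elements. -/
lemma sum_card_oppSide_small_le {R : ℕ} {P : Finset W} {ε : ℝ} (hε : 0 ≤ ε)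
    (hP : ∀ a ∈ P, ∀ b ∈ P, T.cls 0 a b) :
    ∑ x ∈ T.sepPairs R P, (#{t | T.adj s x.1 t ∧
      T.side (T.lev x.1 x.2) x.1 t ≠ T.side (T.lev x.1 x.2) x.2 t ∧
      (#(T.oppSide P (T.lev x.1 x.2) x.1 t) : ℝ) < ε * #P} : ℝ) ≤
      (R + 1) * ε * (#P : ℝ) ^ 2 * D := by
  have h1 : ∀ a ∈ P, ∀ t, (#{b | b ∈ P ∧ ¬ T.cls (R + 1) a b ∧
      T.side (T.lev a b) a t ≠ T.side (T.lev a b) b t ∧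
      (#(T.oppSide P (T.lev a b) a t) : ℝ) < ε * #P} : ℝ) ≤ (R + 1) * (ε * #P) := by
    intro a ha t
    have hsub : ({b | b ∈ P ∧ ¬ T.cls (R + 1) a b ∧
      T.side (T.lev a b) a t ≠ T.side (T.lev a b) b t ∧
      (#(T.oppSide P (T.lev a b) a t) : ℝ) < ε * #P} : Finset W) ⊆
      (range (R + 1)).biUnion fun r =>
        if (#(T.oppSide P r a t) : ℝ) < ε * #P then T.oppSide P r a t else ∅ := by
      intro b hb
      simp only [mem_filter, mem_univ, true_and] at hb
      obtain ⟨hbP, hsep, hside, hsmall⟩ := hb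
      obtain ⟨hl, hl1, -⟩ := T.lev_spec (hP a ha b hbP) hsep
      rw [mem_biUnion]
      refine ⟨T.lev a b, by simp; omega, ?_⟩
      rw [if_pos hsmall]
      simp only [oppSide, mem_filter]
      exact ⟨hbP, (T.cls _).symm hl1, hside.symm⟩
    have h2 := (card_le_card hsub).trans card_biUnion_le
    calc _ ≤ ((∑ r ∈ range (R + 1), #(if (#(T.oppSide P r a t) : ℝ) < ε * #P then
              T.oppSide P r a t else ∅) : ℕ) : ℝ) := by exact_mod_cast h2
      _ ≤ ∑ r ∈ range (R + 1), ε * #P := by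
          push_cast
          refine sum_le_sum fun r _ => ?_
          split_ifs with h
          · exact h.le
          · simp; positivity
      _ = _ := by simp
  calc _ = ∑ a ∈ P, ∑ t with T.adj s a t, (#{b | b ∈ P ∧ ¬ T.cls (R + 1) a b ∧
      T.side (T.lev a b) a t ≠ T.side (T.lev a b) b t ∧
      (#(T.oppSide P (T.lev a b) a t) : ℝ) < ε * #P} : ℝ) := by
        simp only [sepPairs, card_filter, sum_filter, Fintype.sum_prod_type, Nat.cast_sum]
        rw [← sum_filter_add_sum_filter_not univ (fun a => a ∈ P), filter_mem_eq_inter, univ_inter]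
        rw [sum_eq_zero (s := univ.filter fun a => a ∉ P), add_zero]
        · refine sum_congr rfl fun a ha => ?_
          have : ∀ t, (if T.adj s a t then ∑ b : W, (((if b ∈ P ∧ ¬ T.cls (R + 1) a b ∧
              T.side (T.lev a b) a t ≠ T.side (T.lev a b) b t ∧
              (#(T.oppSide P (T.lev a b) a t) : ℝ) < ε * #P then 1 else 0 : ℕ)) : ℝ) else 0) =
              ∑ b : W, if T.adj s a t then (((if b ∈ P ∧ ¬ T.cls (R + 1) a b ∧
              T.side (T.lev a b) a t ≠ T.side (T.lev a b) b t ∧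
              (#(T.oppSide P (T.lev a b) a t) : ℝ) < ε * #P then 1 else 0 : ℕ)) : ℝ) else 0 := by
            intro t; split_ifs <;> simp
          simp only [this]
          rw [sum_comm]
          refine sum_congr rfl fun b _ => ?_
          by_cases hb : b ∈ P ∧ ¬ T.cls (R + 1) a b
          · rw [if_pos ⟨ha, hb⟩]
            refine sum_congr rfl fun t _ => ?_
            by_cases h : T.adj s a t <;> simp [h, hb.1, hb.2]
          · rw [if_neg (fun h => hb h.2)]
            symm
            refine sum_eq_zero fun t _ => ?_
            rw [if_neg (fun h : b ∈ P ∧ ¬ T.cls (R + 1) a b ∧ _ => hb ⟨h.1, h.2.1⟩)]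
            simp
        · intro a ha
          simp only [mem_filter, mem_univ, true_and] at ha
          simp [ha]
    _ ≤ ∑ a ∈ P, ∑ t with T.adj s a t, (R + 1) * (ε * #P) :=
        sum_le_sum fun a ha => sum_le_sum fun t _ => h1 a ha t
    _ = _ := by
        simp only [sum_const, nsmul_eq_mul, T.card_adj]
        ring

/-- Exchanging `a` and `b` turns `sameSide` into `oppSide`. The count of neighbours is preserved by
`card_adj_and`, as the condition on `t` depends on its level-`r` class only. -/
lemma sum_card_sameSide_small_eq {R : ℕ} (hR : R < s) {P : Finset W} {ε : ℝ}
    (hP : ∀ a ∈ P, ∀ b ∈ P, T.cls 0 a b) :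
    ∑ x ∈ T.sepPairs R P, (#{t | T.adj s x.1 t ∧
      T.side (T.lev x.1 x.2) x.1 t ≠ T.side (T.lev x.1 x.2) x.2 t ∧
      (#(T.sameSide P (T.lev x.1 x.2) x.1 t) : ℝ) < ε * #P} : ℝ) =
    ∑ x ∈ T.sepPairs R P, (#{t | T.adj s x.1 t ∧
      T.side (T.lev x.1 x.2) x.1 t ≠ T.side (T.lev x.1 x.2) x.2 t ∧
      (#(T.oppSide P (T.lev x.1 x.2) x.1 t) : ℝ) < ε * #P} : ℝ) := by
  refine sum_nbij' Prod.swap Prod.swap ?_ ?_ (fun _ _ => rfl) (fun _ _ => rfl) ?_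
  · rintro ⟨a, b⟩ h
    simp only [sepPairs, mem_filter, mem_univ, true_and, Prod.swap] at h ⊢
    exact ⟨h.2.1, h.1, fun h' => h.2.2 ((T.cls _).symm h')⟩
  · rintro ⟨a, b⟩ h
    simp only [sepPairs, mem_filter, mem_univ, true_and, Prod.swap] at h ⊢
    exact ⟨h.2.1, h.1, fun h' => h.2.2 ((T.cls _).symm h')⟩
  · rintro ⟨a, b⟩ h
    simp only [sepPairs, mem_filter, mem_univ, true_and, Prod.swap] at h ⊢
    obtain ⟨hl, hl1, -⟩ := T.lev_spec (hP a h.1 b h.2.1) h.2.2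
    rw [T.lev_comm b a]
    have hr : T.lev a b < s := by omega
    have key := T.card_adj_and _ hr a b hl1
      (fun t => T.side (T.lev a b) a t ≠ T.side (T.lev a b) b t ∧
        (#(T.sameSide P (T.lev a b) a t) : ℝ) < ε * #P) (fun t t' htt => by
          rw [T.side_congr_right hr a htt, T.side_congr_right hr b htt,
            ← T.sameSide_congr hr ((T.cls _).refl a) rfl htt])
    refine congrArg Nat.cast (Eq.trans (Eq.trans ?_ key) ?_)
    · congr!
    · congr 1
      ext t
      simp only [mem_filter, mem_univ, true_and]
      refine and_congr_right fun _ => ?_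
      constructor
      · rintro ⟨h1, h2⟩
        rw [T.sameSide_eq_oppSide hl1 h1] at h2
        exact ⟨h1.symm, h2⟩
      · rintro ⟨h1, h2⟩
        rw [← T.sameSide_eq_oppSide hl1 h1.symm] at h2
        exact ⟨h1.symm, h2⟩

variable [DecidableEq W] (Z : Finpartition (univ : Finset W))

/-- Outside of `S` each part of `Z` meets only one class, hence all vertices of the part that are
counted here lie in one and the same small set `nbrSide`. -/
lemma card_nbrSide_small_le {R : ℕ} (hR : R < s) {r : ℕ} (hr : r ≤ R) {ε : ℝ} (hε : 0 ≤ ε)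
    {S : Finset W} (hS : ∀ t ∉ S, ∀ u ∉ S, Z.part t = Z.part u → T.cls R t u) (a : W) :
    (#{t | T.adj (r + 1) a t ∧ t ∉ S ∧ (#(T.nbrSide Z r a t) : ℝ) < ε * #(Z.part t)} : ℝ) ≤
      ε * (2 * N) := by
  have hmaps : ∀ t ∈ ({t | T.adj (r + 1) a t ∧ t ∉ S ∧
      (#(T.nbrSide Z r a t) : ℝ) < ε * #(Z.part t)} : Finset W), Z.part t ∈ Z.parts :=
    fun t _ => Z.part_mem.2 (mem_univ t)
  rw [card_eq_sum_card_fiberwise hmaps, ← T.card_univ, ← Finset.card_univ, ← Z.sum_card_parts]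
  push_cast
  rw [mul_sum]
  refine sum_le_sum fun C hC => ?_
  rw [filter_filter]
  rcases eq_empty_or_nonempty ({t | (T.adj (r + 1) a t ∧ t ∉ S ∧
      (#(T.nbrSide Z r a t) : ℝ) < ε * #(Z.part t)) ∧ Z.part t = C} : Finset W) with h | ⟨t, ht⟩
  · rw [h]; simp; positivity
  · simp only [mem_filter, mem_univ, true_and] at ht
    obtain ⟨⟨ht1, ht2, ht3⟩, rfl⟩ := ht
    refine le_trans ?_ ht3.le
    refine Nat.cast_le.2 (card_le_card fun u hu => ?_)
    simp only [mem_filter, mem_univ, true_and] at hu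
    obtain ⟨⟨hu1, hu2, hu3⟩, hu4⟩ := hu
    simp only [nbrSide, mem_filter]
    exact ⟨hu4 ▸ Z.mem_part_self.2 (mem_univ u),
      T.cls_antitone hr hR.le (hS u hu2 t ht2 hu4), hu1⟩

lemma sum_bigTriples_eq {ε : ℝ} {R : ℕ} {P : Finset W} (g : W → W → W → ℝ) :
    ∑ x ∈ T.bigTriples Z ε R P, g x.1 x.2.1 x.2.2 = ∑ x ∈ T.sepPairs R P,
      ∑ t with T.adj (T.lev x.1 x.2 + 1) x.1 t ∧
        T.side (T.lev x.1 x.2) x.1 t ≠ T.side (T.lev x.1 x.2) x.2 t ∧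
        ε * #P ≤ #(T.sameSide P (T.lev x.1 x.2) x.1 t) ∧
        ε * #P ≤ #(T.oppSide P (T.lev x.1 x.2) x.1 t) ∧
        ε * #(Z.part t) ≤ #(T.nbrSide Z (T.lev x.1 x.2) x.1 t), g x.1 x.2 t := by
  simp only [bigTriples, sepPairs, sum_filter, Fintype.sum_prod_type]
  refine sum_congr rfl fun a _ => sum_congr rfl fun b _ => ?_
  by_cases h : a ∈ P ∧ b ∈ P ∧ ¬ T.cls (R + 1) a b
  · rw [if_pos h]
    simp only [h.1, h.2.1, h.2.2, not_false_eq_true, true_and]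
  · rw [if_neg h]
    exact sum_eq_zero fun t _ => if_neg fun h' => h ⟨h'.1, h'.2.1, h'.2.2.1⟩

lemma card_bigTriples_le {ε : ℝ} {R : ℕ} (hR : R < s) {P : Finset W} {G' : SimpleGraph W}
    (hε : 0 ≤ ε) (hZ : ∀ P ∈ Z.parts, ∀ a ∈ P, ∀ b ∈ P, T.cls 0 a b)
    (hreg : IsPerfectlyRegular G' ε Z) (hP : P ∈ Z.parts) :
    ∑ x ∈ T.bigTriples Z ε R P, (if T.adj s x.1 x.2.2 then (1 : ℝ) else 0) ≤
      #(T.sepPairs R P) * (2 * ε * N) + 2 * #P * ∑ a ∈ P, ∑ t, T.edit G' a t := by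
  have hpt : ∀ x ∈ T.bigTriples Z ε R P, (if T.adj s x.1 x.2.2 then (1 : ℝ) else 0) ≤
      ((if G'.Adj x.1 x.2.2 then (1 : ℝ) else 0) - (if G'.Adj x.2.1 x.2.2 then 1 else 0) - 2 * ε)
      + (2 * ε + T.edit G' x.1 x.2.2 + T.edit G' x.2.1 x.2.2) := by
    rintro ⟨a, b, t⟩ hx
    simp only [bigTriples, mem_filter, mem_univ, true_and] at hx
    obtain ⟨ha, hb, hsep, hadj, hside, -⟩ := hx
    obtain ⟨hl, hl1, -⟩ := T.lev_spec (hZ P hP a ha b hb) hsep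
    have hb' : ¬ T.adj s b t := fun h => hside
      ((T.adj_succ_iff _ (by omega) a b t hl1 hadj).1 (T.adj_antitone (by omega) le_rfl h))
    simp only [edit, hb', false_iff]
    by_cases h1 : T.adj s a t <;> by_cases h2 : G'.Adj a t <;> by_cases h3 : G'.Adj b t <;>
      simp [h1, h2, h3] <;> linarith
  have h2 : ∑ x ∈ T.bigTriples Z ε R P,
      (2 * ε + T.edit G' x.1 x.2.2 + T.edit G' x.2.1 x.2.2) ≤
      #(T.sepPairs R P) * (2 * ε * N) + 2 * #P * ∑ a ∈ P, ∑ t, T.edit G' a t := by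
    rw [T.sum_bigTriples_eq Z (fun a b t => 2 * ε + T.edit G' a t + T.edit G' b t)]
    have hsub : T.sepPairs R P ⊆ P ×ˢ P := by
      intro x hx
      simp only [sepPairs, mem_filter] at hx
      exact mem_product.2 ⟨hx.2.1, hx.2.2.1⟩
    calc _ ≤ ∑ x ∈ T.sepPairs R P, (2 * ε * N + ∑ t, (T.edit G' x.1 t + T.edit G' x.2 t)) := by
          refine sum_le_sum fun x hx => ?_
          simp only [add_assoc]
          rw [sum_add_distrib]
          refine add_le_add ?_ (sum_le_sum_of_subset_of_nonneg (filter_subset _ _) fun _ _ _ =>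
            add_nonneg (T.edit_nonneg _ _ _) (T.edit_nonneg _ _ _))
          rw [sum_const, nsmul_eq_mul, mul_comm]
          refine mul_le_mul_of_nonneg_left (le_trans ?_ (T.card_adj_zero x.1)) (by positivity)
          refine Nat.cast_le.2 (card_le_card fun t ht => ?_)
          simp only [sepPairs, mem_filter, mem_univ, true_and] at ht hx ⊢
          obtain ⟨hl, -⟩ := T.lev_spec (hZ P hP _ hx.1 _ hx.2.1) hx.2.2
          exact T.adj_antitone (Nat.zero_le _) (by omega) ht.1
      _ = #(T.sepPairs R P) * (2 * ε * N) +
          ∑ x ∈ T.sepPairs R P, ∑ t, (T.edit G' x.1 t + T.edit G' x.2 t) := by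
          rw [sum_add_distrib, sum_const, nsmul_eq_mul]
      _ ≤ #(T.sepPairs R P) * (2 * ε * N) +
          ∑ x ∈ P ×ˢ P, ∑ t, (T.edit G' x.1 t + T.edit G' x.2 t) := by
          gcongr
          exact fun _ _ _ => sum_nonneg fun _ _ =>
            add_nonneg (T.edit_nonneg _ _ _) (T.edit_nonneg _ _ _)
      _ = _ := by
          rw [sum_product]
          simp only [sum_add_distrib, sum_const, nsmul_eq_mul]
          rw [← mul_sum]
          ring
  calc _ ≤ _ := sum_le_sum hpt
    _ ≤ _ := by
      rw [sum_add_distrib]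
      linarith [T.sum_bigTriples_le hR hZ hreg hP]

/-- The main inequality for one part `P` of `Z`. The left side is the number of separated pairs
times what remains of the `7/16 D` separating neighbours after those with a small `nbrSide` and
those that regularity permits are removed. On the right are the neighbours in the
exceptional set `S`, the triples with a small side, and the edits. -/
lemma part_bound {R : ℕ} (hR : R < s) {P : Finset W} {G' : SimpleGraph W} {ε : ℝ}
    (hε : 0 ≤ ε) (hZ : ∀ P ∈ Z.parts, ∀ a ∈ P, ∀ b ∈ P, T.cls 0 a b)
    (hreg : IsPerfectlyRegular G' ε Z) (hP : P ∈ Z.parts)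
    {S : Finset W} (hS : ∀ t ∉ S, ∀ u ∉ S, Z.part t = Z.part u → T.cls R t u) :
    #(T.sepPairs R P) * (7 / 16 * D - 4 * ε * N) ≤
      ∑ x ∈ T.sepPairs R P, (#{t | T.adj s x.1 t ∧ t ∈ S} : ℝ) +
      2 * ((R + 1) * ε * (#P : ℝ) ^ 2 * D) + 2 * #P * ∑ a ∈ P, ∑ t, T.edit G' a t := by
  have hpair : ∀ x ∈ T.sepPairs R P, 7 / 16 * D ≤
      (#{t | T.adj s x.1 t ∧ t ∈ S} : ℝ) + ε * (2 * N) +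
      (#{t | T.adj s x.1 t ∧ T.side (T.lev x.1 x.2) x.1 t ≠ T.side (T.lev x.1 x.2) x.2 t ∧
        (#(T.sameSide P (T.lev x.1 x.2) x.1 t) : ℝ) < ε * #P} : ℝ) +
      (#{t | T.adj s x.1 t ∧ T.side (T.lev x.1 x.2) x.1 t ≠ T.side (T.lev x.1 x.2) x.2 t ∧
        (#(T.oppSide P (T.lev x.1 x.2) x.1 t) : ℝ) < ε * #P} : ℝ) +
      ∑ t with T.adj (T.lev x.1 x.2 + 1) x.1 t ∧
        T.side (T.lev x.1 x.2) x.1 t ≠ T.side (T.lev x.1 x.2) x.2 t ∧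
        ε * #P ≤ #(T.sameSide P (T.lev x.1 x.2) x.1 t) ∧
        ε * #P ≤ #(T.oppSide P (T.lev x.1 x.2) x.1 t) ∧
        ε * #(Z.part t) ≤ #(T.nbrSide Z (T.lev x.1 x.2) x.1 t),
        (if T.adj s x.1 t then (1 : ℝ) else 0) := by
    rintro ⟨a, b⟩ hx
    simp only [sepPairs, mem_filter, mem_univ, true_and] at hx
    obtain ⟨hl, hl1, hl2⟩ := T.lev_spec (hZ P hP _ hx.1 _ hx.2.1) hx.2.2
    refine (T.le_card_side_ne (by omega) hl1 hl2).trans ?_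
    dsimp only
    set r := T.lev a b
    have h3 := T.card_nbrSide_small_le Z hR hl hε hS a
    rw [← sum_filter, filter_filter, sum_const, nsmul_eq_mul, mul_one]
    refine le_trans ?_ (add_le_add_left (add_le_add_left (add_le_add_left
      (add_le_add_right h3 _) _) _) _)
    norm_cast
    refine le_trans (card_le_card ?_) ((card_union_le _ _).trans (add_le_add_left
      ((card_union_le _ _).trans (add_le_add_left ((card_union_le _ _).trans
      (add_le_add_left (card_union_le _ _) _)) _)) _))
    intro t ht
    simp only [mem_filter, mem_univ, true_and, mem_union] at ht ⊢
    have hadj : T.adj (r + 1) a t := T.adj_antitone (by omega) le_rfl ht.1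
    by_cases c1 : t ∈ S
    · simp [c1, ht.1]
    by_cases c2 : (#(T.nbrSide Z r a t) : ℝ) < ε * #(Z.part t)
    · simp [c1, c2, hadj]
    by_cases c3 : (#(T.sameSide P r a t) : ℝ) < ε * #P
    · simp [c3, ht.1, ht.2]
    by_cases c4 : (#(T.oppSide P r a t) : ℝ) < ε * #P
    · simp [c4, ht.1, ht.2]
    exact Or.inr ⟨⟨hadj, ht.2, not_lt.1 c3, not_lt.1 c4, not_lt.1 c2⟩, ht.1⟩
  have hsum := sum_le_sum hpair
  rw [sum_const, nsmul_eq_mul] at hsum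
  simp only [sum_add_distrib] at hsum
  rw [← T.sum_bigTriples_eq Z (fun a b t => if T.adj s a t then (1 : ℝ) else 0), sum_const,
    nsmul_eq_mul] at hsum
  have hP0 := hZ P hP
  have h1 := T.card_bigTriples_le Z hR hε hZ hreg hP
  have h2 := T.sum_card_oppSide_small_le (R := R) hε hP0
  rw [T.sum_card_sameSide_small_eq hR hP0] at hsum
  linarith

end BlowupTower

end Counting

/-! ### Concentration of parts, level by level -/

section Concentration

open Finset
open scoped Classical

namespace BlowupTower

variable {W : Type*} [Fintype W] {s : ℕ} {p N D : ℝ} (T : BlowupTower W s p N D)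

/-- Mixing: by the Cauchy-Schwarz inequality, the weighted number of edges to `S` is controlled by
the codegrees. Pairs in the same class of level `0` are the second term; there are few of them. -/
lemma sq_sum_mul_card_le {σ : W → ℝ} (h0 : ∀ a, 0 ≤ σ a) (h1 : ∀ a, σ a ≤ 1)
    (hp : 0 ≤ p) (hD : 0 ≤ D) (S : Finset W) :
    (∑ a, σ a * #{t | T.adj s a t ∧ t ∈ S}) ^ 2 ≤
      #S * (2 * p * D * (∑ a, σ a) ^ 2 + p ^ 2 * N * D * ∑ a, σ a) := by
  set F : W → ℝ := fun t => ∑ a, σ a * (if T.adj s a t then 1 else 0) with hF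
  have e1 : ∑ a, σ a * (#{t | T.adj s a t ∧ t ∈ S} : ℝ) = ∑ t ∈ S, F t := by
    rw [hF, sum_comm]
    refine sum_congr rfl fun a _ => ?_
    rw [← mul_sum, ← sum_filter, sum_const, nsmul_eq_mul, mul_one]
    congr 3
    ext t
    simp [and_comm]
  have e2 : ∑ t, F t ^ 2 = ∑ a, ∑ b, σ a * σ b * (#{t | T.adj s a t ∧ T.adj s b t} : ℝ) := by
    simp only [hF, sq, sum_mul_sum]
    rw [sum_comm]
    refine sum_congr rfl fun a _ => ?_
    rw [sum_comm]
    refine sum_congr rfl fun b _ => ?_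
    rw [card_filter]
    push_cast
    rw [mul_sum]
    refine sum_congr rfl fun t _ => ?_
    by_cases ha : T.adj s a t <;> by_cases hb : T.adj s b t <;> simp [ha, hb]
  have e3 : ∀ a b, (#{t | T.adj s a t ∧ T.adj s b t} : ℝ) ≤
      2 * p * D + (if T.cls 0 a b then 1 else 0) * D := by
    intro a b
    by_cases h : T.cls 0 a b
    · have : (#{t | T.adj s a t ∧ T.adj s b t} : ℝ) ≤ D := by
        refine le_trans (Nat.cast_le.2 (card_le_card fun t => ?_)) (T.card_adj a).le
        simp +contextual
      rw [if_pos h]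
      have : 0 ≤ 2 * p * D := by positivity
      linarith
    · simpa [h] using T.codegree a b h
  have e4 : ∀ a, ∑ b, σ b * (if T.cls 0 a b then (1 : ℝ) else 0) ≤ p ^ 2 * N := by
    intro a
    refine le_trans ?_ (T.card_cls_zero a)
    rw [card_filter]
    push_cast
    refine sum_le_sum fun b _ => ?_
    split_ifs
    · simpa using h1 b
    · simp
  rw [e1]
  refine sq_sum_le_card_mul_sum_sq.trans (mul_le_mul_of_nonneg_left ?_ (by positivity))
  calc ∑ t ∈ S, F t ^ 2 ≤ ∑ t, F t ^ 2 :=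
        sum_le_sum_of_subset_of_nonneg (subset_univ _) fun _ _ _ => sq_nonneg _
    _ ≤ ∑ a, ∑ b, σ a * σ b * (2 * p * D + (if T.cls 0 a b then 1 else 0) * D) := by
        rw [e2]
        exact sum_le_sum fun a _ => sum_le_sum fun b _ =>
          mul_le_mul_of_nonneg_left (e3 a b) (mul_nonneg (h0 a) (h0 b))
    _ = 2 * p * D * (∑ a, σ a) ^ 2 +
        D * ∑ a, σ a * ∑ b, σ b * (if T.cls 0 a b then (1 : ℝ) else 0) := by
        rw [sq, sum_mul_sum, mul_sum, mul_sum, ← sum_add_distrib]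
        refine sum_congr rfl fun a _ => ?_
        rw [mul_sum, mul_sum, mul_sum, ← sum_add_distrib]
        exact sum_congr rfl fun b _ => by ring
    _ ≤ 2 * p * D * (∑ a, σ a) ^ 2 + D * ∑ a, σ a * (p ^ 2 * N) := by
        gcongr with a _
        · exact h0 a
        · exact e4 a
    _ = _ := by rw [← sum_mul]; ring

/-- All but at most a `γ`-fraction of `P` lies in one class of level `R`. -/
def Concentrated (γ : ℝ) (R : ℕ) (P : Finset W) : Prop :=
  ∃ y, (#{u ∈ P | ¬ T.cls R u y} : ℝ) ≤ γ * #P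

lemma sum_sepPairs_fst (R : ℕ) (P : Finset W) (f : W → ℝ) :
    ∑ x ∈ T.sepPairs R P, f x.1 = ∑ a ∈ P, (#{b ∈ P | ¬ T.cls (R + 1) a b} : ℝ) * f a := by
  have : T.sepPairs R P = {x ∈ P ×ˢ P | ¬ T.cls (R + 1) x.1 x.2} := by
    ext x; simp [sepPairs, and_assoc]
  rw [this, sum_filter, sum_product]
  refine sum_congr rfl fun a _ => ?_
  rw [← sum_filter]
  dsimp only
  rw [sum_const, nsmul_eq_mul]

lemma sum_edit_le {δ : ℝ} {G G' : SimpleGraph W} (hG : ∀ a b, G.Adj a b ↔ T.adj s a b)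
    (h : IsClose δ G G') : ∑ a, ∑ t, T.edit G' a t ≤ 2 * δ * N * D := by
  obtain ⟨H, hH⟩ : ∃ H : SimpleGraph W, H = (G \ G') ⊔ (G' \ G) := ⟨_, rfl⟩
  have hset : H.edgeSet = symmDiff G.edgeSet G'.edgeSet := by
    rw [hH, SimpleGraph.edgeSet_sup, SimpleGraph.edgeSet_sdiff, SimpleGraph.edgeSet_sdiff]
    rfl
  have hcard : ∀ K : SimpleGraph W, ∑ a, (#{t | K.Adj a t} : ℝ) = 2 * (K.edgeSet.ncard : ℝ) := by
    intro K
    rw [← SimpleGraph.coe_edgeFinset, Set.ncard_coe_finset]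
    have := K.sum_degrees_eq_twice_card_edges
    rw [← Nat.cast_sum]
    norm_cast
    rw [← this]
    refine sum_congr rfl fun a _ => ?_
    rw [← SimpleGraph.card_neighborFinset_eq_degree, SimpleGraph.neighborFinset_eq_filter]
  have h1 : ∑ a, ∑ t, T.edit G' a t = ∑ a, (#{t | H.Adj a t} : ℝ) := by
    refine sum_congr rfl fun a _ => ?_
    rw [card_filter]
    push_cast
    refine sum_congr rfl fun t _ => ?_
    simp only [edit, hH, SimpleGraph.sup_adj, SimpleGraph.sdiff_adj, hG]
    by_cases c1 : T.adj s a t <;> by_cases c2 : G'.Adj a t <;> simp [c1, c2]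
  have h2 : (2 * N) * D = 2 * (G.edgeSet.ncard : ℝ) := by
    rw [← hcard G]
    simp only [hG, T.card_adj, sum_const, nsmul_eq_mul, Finset.card_univ, T.card_univ]
  rw [h1, hcard, hset]
  unfold IsClose at h
  have : (G.edgeSet.ncard : ℝ) = N * D := by linarith
  rw [this] at h
  linarith

variable [DecidableEq W] {Z : Finpartition (univ : Finset W)}

/-- The exceptional set consists of the non-concentrated parts of `Z` and, for each concentrated
part, of its vertices outside of a class witnessing concentration. -/
lemma exists_exceptional [Nonempty W] {γ : ℝ} (hγ : 0 ≤ γ) {R : ℕ}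
    (h : ∑ P ∈ Z.parts with ¬ T.Concentrated γ R P, (#P : ℝ) ≤ γ * (2 * N)) :
    ∃ S : Finset W, (#S : ℝ) ≤ 4 * γ * N ∧
      ∀ t ∉ S, ∀ u ∉ S, Z.part t = Z.part u → T.cls R t u := by
  have hc : ∀ P : Finset W, ∃ y, T.Concentrated γ R P →
      (#{u ∈ P | ¬ T.cls R u y} : ℝ) ≤ γ * #P := by
    intro P
    by_cases hP : T.Concentrated γ R P
    · obtain ⟨y, hy⟩ := hP
      exact ⟨y, fun _ => hy⟩
    · exact ⟨Classical.arbitrary W, fun h => absurd h hP⟩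
  choose c hc using hc
  refine ⟨univ.filter fun u => ¬ T.Concentrated γ R (Z.part u) ∨
    ¬ T.cls R u (c (Z.part u)), ?_, ?_⟩
  · have hmaps : ∀ t ∈ ({u | ¬ T.Concentrated γ R (Z.part u) ∨
        ¬ T.cls R u (c (Z.part u))} : Finset W), Z.part t ∈ Z.parts :=
      fun t _ => Z.part_mem.2 (mem_univ t)
    rw [card_eq_sum_card_fiberwise hmaps]
    push_cast
    have hP : ∀ P ∈ Z.parts, (#{u ∈ ({u | ¬ T.Concentrated γ R (Z.part u) ∨
        ¬ T.cls R u (c (Z.part u))} : Finset W) | Z.part u = P} : ℝ) ≤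
        (if ¬ T.Concentrated γ R P then (#P : ℝ) else 0) + γ * #P := by
      intro P hP
      by_cases hPc : T.Concentrated γ R P
      · rw [if_neg (not_not.2 hPc), zero_add]
        refine le_trans (Nat.cast_le.2 (card_le_card fun u hu => ?_)) (hc P hPc)
        simp only [mem_filter, mem_univ, true_and] at hu ⊢
        obtain ⟨hu1, rfl⟩ := hu
        exact ⟨Z.mem_part_self.2 (mem_univ u), hu1.resolve_left (not_not.2 hPc)⟩
      · rw [if_pos hPc]
        refine le_trans (Nat.cast_le.2 (card_le_card fun u hu => ?_))
          (le_add_of_nonneg_right (by positivity))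
        simp only [mem_filter, mem_univ, true_and] at hu
        exact hu.2 ▸ Z.mem_part_self.2 (mem_univ u)
    refine (sum_le_sum hP).trans ?_
    have hsum : ∑ P ∈ Z.parts, (#P : ℝ) = 2 * N := by
      rw [← Nat.cast_sum, Z.sum_card_parts, Finset.card_univ, T.card_univ]
    rw [sum_add_distrib, ← sum_filter, ← mul_sum, hsum]
    linarith
  · intro t ht u hu htu
    simp only [mem_filter, mem_univ, true_and, not_or, not_not] at ht hu
    rw [htu] at ht
    exact (T.cls R).trans ht.2 ((T.cls R).symm hu.2)

lemma sum_parts (Z : Finpartition (univ : Finset W)) (f : W → ℝ) :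
    ∑ P ∈ Z.parts, ∑ a ∈ P, f a = ∑ a, f a := by
  rw [← sum_congr Z.biUnion_parts fun _ _ => rfl, sum_biUnion Z.disjoint]
  rfl

/-- The mixing bound for an exceptional set of size at most `4 γ N`. The hypothesis `Q ≥ 2 γ² N`
makes the main term dominate the one for pairs in a common class of level `0`. -/
lemma le_of_sq_le_mixing_bound {p N D γ Q S X : ℝ} (hp : 0 ≤ p) (hN : 0 ≤ N) (hD : 0 ≤ D)
    (hγ : 0 ≤ γ) (hγ1 : γ ≤ 1 / 1024) (hDN : D = p * N) (hpγ : p ≤ 2 * γ ^ 2)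
    (hS : S ≤ 4 * γ * N) (hQ : 2 * γ ^ 2 * N ≤ Q)
    (hX : X ^ 2 ≤ S * (2 * p * D * Q ^ 2 + p ^ 2 * N * D * Q)) : X ≤ D * Q / 8 := by
  have hQ0 : 0 ≤ Q := le_trans (by positivity) hQ
  refine (le_abs_self X).trans (abs_le_of_sq_le_sq (hX.trans ?_) (by positivity))
  have hpN : p * N ≤ Q := le_trans (by gcongr) hQ
  calc S * (2 * p * D * Q ^ 2 + p ^ 2 * N * D * Q) ≤
      (4 * γ * N) * (2 * p * D * Q ^ 2 + p * D * Q * Q) := by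
        have : p ^ 2 * N * D * Q ≤ p * D * Q * Q :=
          calc p ^ 2 * N * D * Q = p * D * (p * N) * Q := by ring
            _ ≤ _ := by gcongr
        gcongr
    _ = 12 * γ * (D * (p * N)) * Q ^ 2 := by ring
    _ = 12 * γ * D ^ 2 * Q ^ 2 := by rw [← hDN]; ring
    _ ≤ 12 * (1 / 1024) * D ^ 2 * Q ^ 2 := by gcongr
    _ ≤ (D * Q / 8) ^ 2 := by
        have : 0 ≤ D ^ 2 * Q ^ 2 := by positivity
        linarith

/-- The induction step, from level `R` to level `R + 1`. -/
lemma card_not_concentrated_succ {γ δ : ℝ} (hp : 0 < p) (hN : 0 < N) (hγ : 0 < γ)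
    (hγ1 : γ ≤ 1 / 1024) (hsp : 4 * s * p ≤ γ) (hpγ : p ≤ 2 * γ ^ 2) (hδγ : 64 * δ ≤ γ ^ 2)
    {G' : SimpleGraph W} (hedit : ∑ a, ∑ t, T.edit G' a t ≤ 2 * δ * N * D)
    (hZ : ∀ P ∈ Z.parts, ∀ a ∈ P, ∀ b ∈ P, T.cls 0 a b)
    (hreg : IsPerfectlyRegular G' (p / 16) Z) {R : ℕ} (hR : R < s)
    (h : ∑ P ∈ Z.parts with ¬ T.Concentrated γ R P, (#P : ℝ) ≤ γ * (2 * N)) :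
    ∑ P ∈ Z.parts with ¬ T.Concentrated γ (R + 1) P, (#P : ℝ) ≤ γ * (2 * N) := by
  have hD : 0 < D := by rw [T.D_eq]; positivity
  have : Nonempty W := by
    by_contra hne
    have := T.card_univ
    rw [not_nonempty_iff] at hne
    rw [Fintype.card_eq_zero] at this
    simp at this
    linarith
  by_contra hcon
  push Not at hcon
  obtain ⟨S, hScard, hS⟩ := T.exists_exceptional hγ.le h
  set c : W → ℝ := fun a => #{b ∈ Z.part a | ¬ T.cls (R + 1) a b} with hc
  set σ : W → ℝ := fun a => if T.Concentrated γ (R + 1) (Z.part a) then 0 else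
    c a / #(Z.part a) with hσ
  set n : W → ℝ := fun a => #{t | T.adj s a t ∧ t ∈ S} with hn
  have hc0 : ∀ a, 0 ≤ c a := fun a => by simp [hc]
  have hσ0 : ∀ a, 0 ≤ σ a := by
    intro a
    simp only [hσ]
    split_ifs
    · rfl
    · exact div_nonneg (hc0 a) (by positivity)
  have hσ1 : ∀ a, σ a ≤ 1 := by
    intro a
    simp only [hσ]
    split_ifs
    · norm_num
    · exact div_le_one_of_le₀ (Nat.cast_le.2 (card_le_card (filter_subset _ _))) (by positivity)
  have hcγ : ∀ a, ¬ T.Concentrated γ (R + 1) (Z.part a) → γ * #(Z.part a) < c a := by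
    intro a ha
    by_contra hlt
    -- otherwise the class of `a` itself would witness concentration
    refine ha ⟨a, ?_⟩
    rw [not_lt] at hlt
    simpa only [hc, (T.cls (R + 1)).comm (x := a)] using hlt
  -- `part_bound` divided by `|P|`; here `5 / 32 = 7 / 16 - 1 / 4 - 1 / 32`, where `1 / 4` is
  -- `4 ε N / D` and `1 / 32` pays for the triples with a small side.
  have hpart : ∀ P ∈ Z.parts, 5 / 32 * D * ∑ a ∈ P, σ a ≤
      ∑ a ∈ P, σ a * n a + 2 * ∑ a ∈ P, ∑ t, T.edit G' a t := by
    intro P hP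
    have hPa : ∀ a ∈ P, Z.part a = P := fun a ha => Z.part_eq_of_mem hP ha
    have hed : 0 ≤ ∑ a ∈ P, ∑ t, T.edit G' a t :=
      sum_nonneg fun _ _ => sum_nonneg fun _ _ => T.edit_nonneg _ _ _
    by_cases hPc : T.Concentrated γ (R + 1) P
    · have : ∀ a ∈ P, σ a = 0 := fun a ha => by simp [hσ, hPa a ha, hPc]
      rw [sum_eq_zero this, sum_eq_zero (fun a ha => by rw [this a ha, zero_mul])]
      linarith
    · have hP0 : (0 : ℝ) < #P := Nat.cast_pos.2 (card_pos.2 (Z.nonempty_of_mem_parts hP))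
      have hσP : ∀ a ∈ P, c a = #P * σ a := fun a ha => by
        simp only [hσ, hPa a ha, if_neg hPc]; field_simp
      have hcP : ∀ a ∈ P, (#{b ∈ P | ¬ T.cls (R + 1) a b} : ℝ) = c a := fun a ha => by
        simp only [hc, hPa a ha]
      have hb := T.part_bound Z hR (by positivity) hZ hreg hP hS
      have s1 : (#(T.sepPairs R P) : ℝ) = #P * ∑ a ∈ P, σ a := by
        have := T.sum_sepPairs_fst R P (fun _ => 1)
        simp only [sum_const, nsmul_eq_mul, mul_one] at this
        rw [this, mul_sum]
        exact sum_congr rfl fun a ha => by rw [hcP a ha, hσP a ha]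
      have s2 : ∑ x ∈ T.sepPairs R P, (#{t | T.adj s x.1 t ∧ t ∈ S} : ℝ) =
          #P * ∑ a ∈ P, σ a * n a := by
        rw [T.sum_sepPairs_fst R P n, mul_sum]
        exact sum_congr rfl fun a ha => by rw [hcP a ha, hσP a ha, mul_assoc]
      have s3 : γ * #P ≤ ∑ a ∈ P, σ a := by
        rw [mul_comm, ← nsmul_eq_mul]
        refine card_nsmul_le_sum _ _ _ fun a ha => ?_
        have := hcγ a (by rwa [hPa a ha])
        rw [hσP a ha, hPa a ha, mul_comm] at this
        exact (lt_of_mul_lt_mul_left this hP0.le).le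
      rw [s1, s2] at hb
      have hRs : ((R : ℝ) + 1) ≤ s := by exact_mod_cast hR
      have s4 : 2 * (((R : ℝ) + 1) * (p / 16) * (#P : ℝ) ^ 2 * D) ≤
          #P * (D / 32 * ∑ a ∈ P, σ a) := by
        have : ((R : ℝ) + 1) * p ≤ γ / 4 := by
          have := mul_le_mul_of_nonneg_right hRs hp.le
          linarith
        calc 2 * (((R : ℝ) + 1) * (p / 16) * (#P : ℝ) ^ 2 * D) =
            (((R : ℝ) + 1) * p) * ((#P : ℝ) ^ 2 * D / 8) := by ring
          _ ≤ γ / 4 * ((#P : ℝ) ^ 2 * D / 8) := by gcongr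
          _ = #P * (D / 32 * (γ * #P)) := by ring
          _ ≤ _ := by gcongr
      have s5 : (#P : ℝ) * (5 / 32 * D * ∑ a ∈ P, σ a) ≤
          #P * (∑ a ∈ P, σ a * n a + 2 * ∑ a ∈ P, ∑ t, T.edit G' a t) := by
        have e : 7 / 16 * D - 4 * (p / 16) * N = 3 / 16 * D := by rw [T.D_eq]; ring
        rw [e] at hb
        linarith
      exact le_of_mul_le_mul_left s5 hP0
  have hall := sum_le_sum hpart
  rw [← mul_sum, sum_add_distrib, ← mul_sum, sum_parts, sum_parts, sum_parts] at hall
  have hσsum : 2 * γ ^ 2 * N < ∑ a, σ a := by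
    calc 2 * γ ^ 2 * N = γ * (γ * (2 * N)) := by ring
      _ < γ * ∑ P ∈ Z.parts with ¬ T.Concentrated γ (R + 1) P, (#P : ℝ) := by gcongr
      _ = ∑ P ∈ Z.parts with ¬ T.Concentrated γ (R + 1) P, ∑ a ∈ P, γ := by
          simp [mul_sum, mul_comm]
      _ ≤ ∑ P ∈ Z.parts with ¬ T.Concentrated γ (R + 1) P, ∑ a ∈ P, σ a := by
          refine sum_le_sum fun P hP => sum_le_sum fun a ha => ?_
          rw [mem_filter] at hP
          have hPa := Z.part_eq_of_mem hP.1 ha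
          have hP0 : (0 : ℝ) < #P := Nat.cast_pos.2 (card_pos.2 ⟨a, ha⟩)
          simp only [hσ, hPa, if_neg hP.2]
          have := hcγ a (by rw [hPa]; exact hP.2)
          rw [hPa] at this
          exact (le_div_iff₀ hP0).2 this.le
      _ ≤ ∑ P ∈ Z.parts, ∑ a ∈ P, σ a := sum_le_sum_of_subset_of_nonneg (filter_subset _ _)
          fun _ _ _ => sum_nonneg fun _ _ => hσ0 _
      _ = _ := sum_parts Z σ
  have hmix' : ∑ a, σ a * n a ≤ D * (∑ a, σ a) / 8 :=
    le_of_sq_le_mixing_bound hp.le hN.le hD.le hγ.le hγ1 T.D_eq hpγ hScard hσsum.le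
      (by convert T.sq_sum_mul_card_le hσ0 hσ1 hp.le hD.le S)
  generalize ∑ a, σ a = Q at *
  have hfin : D * (Q / 32) ≤ D * (4 * δ * N) := by linarith
  have h1 := le_of_mul_le_mul_left hfin hD
  have h2 : 2 * γ ^ 2 * N < 128 * δ * N := by linarith
  have h3 := lt_of_mul_lt_mul_right h2 hN.le
  linarith

theorem card_not_concentrated_le {γ δ : ℝ} (hp : 0 < p) (hN : 0 < N) (hγ : 0 < γ)
    (hγ1 : γ ≤ 1 / 1024) (hsp : 4 * s * p ≤ γ) (hpγ : p ≤ 2 * γ ^ 2) (hδγ : 64 * δ ≤ γ ^ 2)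
    {G' : SimpleGraph W} (hedit : ∑ a, ∑ t, T.edit G' a t ≤ 2 * δ * N * D)
    (hZ : ∀ P ∈ Z.parts, ∀ a ∈ P, ∀ b ∈ P, T.cls 0 a b)
    (hreg : IsPerfectlyRegular G' (p / 16) Z) {R : ℕ} (hR : R ≤ s) :
    ∑ P ∈ Z.parts with ¬ T.Concentrated γ R P, (#P : ℝ) ≤ γ * (2 * N) := by
  induction R with
  | zero =>
    rw [sum_eq_zero]
    · positivity
    · intro P hP
      rw [mem_filter] at hP
      obtain ⟨y, hy⟩ := Z.nonempty_of_mem_parts hP.1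
      refine absurd ⟨y, ?_⟩ hP.2
      rw [filter_false_of_mem fun u hu => not_not.2 (hZ P hP.1 u hu y hy)]
      simp only [card_empty, Nat.cast_zero]
      positivity
  | succ R ih =>
    exact T.card_not_concentrated_succ hp hN hγ hγ1 hsp hpγ hδγ hedit hZ hreg hR (ih (by omega))

end BlowupTower

end Concentration

/-! ### Degrees and codegrees in the construction -/

section Levels

open Finset
open scoped Classical

section Step
variable {V : Type*} [Fintype V] {G : SimpleGraph V} {n d : ℕ} {α β : ℝ}
  {H : SimpleGraph (V × Fin n)}

/-- By equitability, each neighbour of `u.1` gives rise to exactly `n / 2` neighbours of `u`. -/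
lemma IsModifiedBlowup.card_adj_and (h : IsModifiedBlowup G n d α β H) (u : V × Fin n)
    (φ : V → Prop) :
    (#{v : V × Fin n | H.Adj u v ∧ φ v.1} : ℝ) = #{y | G.Adj u.1 y ∧ φ y} * ((n : ℝ) / 2) := by
  obtain ⟨side, swap, hseq, hadj⟩ := h
  rw [card_filter, card_filter, Fintype.sum_prod_type]
  push_cast
  rw [sum_mul]
  refine sum_congr rfl fun y _ => ?_
  by_cases hy : G.Adj u.1 y ∧ φ y
  · rw [if_pos hy, one_mul]
    have h1 := (hseq y).equitable ⟨u.1, hy.1.symm⟩ (side u.1 y u.2 ^^ swap s(u.1, y))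
    rw [Set.ncard_eq_toFinset_card', Set.toFinset_ofPred, card_filter] at h1
    have h2 := congrArg (Nat.cast : ℕ → ℝ) h1
    push_cast at h2
    rw [eq_div_iff two_ne_zero, mul_comm, ← h2]
    congr 1
    refine sum_congr rfl fun i _ => ?_
    congr 1
    simp only [hadj, hy, true_and, and_true, eq_iff_iff]
    cases side u.1 y u.2 <;> cases side y u.1 i <;> cases swap s(u.1, y) <;> simp
  · rw [if_neg hy, zero_mul]
    refine sum_eq_zero fun i _ => if_neg fun h' => hy ⟨?_, h'.2⟩
    exact ((hadj u (y, i)).1 h'.1).1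

/-- By orthogonality, each common neighbour of `u.1` and `v.1` gives rise to at most `(1 / 4 + α) n`
common neighbours of `u` and `v`. -/
lemma IsModifiedBlowup.codegree_le (h : IsModifiedBlowup G n d α β H) {u v : V × Fin n}
    (huv : u.1 ≠ v.1) :
    (#{w : V × Fin n | H.Adj u w ∧ H.Adj v w} : ℝ) ≤
      #{y | G.Adj u.1 y ∧ G.Adj v.1 y} * ((1 / 4 + α) * n) := by
  obtain ⟨side, swap, hseq, hadj⟩ := h
  rw [card_filter, card_filter, Fintype.sum_prod_type]
  push_cast
  rw [sum_mul]
  refine sum_le_sum fun y _ => ?_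
  by_cases hy : G.Adj u.1 y ∧ G.Adj v.1 y
  · rw [if_pos hy, one_mul]
    have h1 := (hseq y).orthogonal ⟨u.1, hy.1.symm⟩ ⟨v.1, hy.2.symm⟩
      (fun h => huv (congrArg Subtype.val h)) (side u.1 y u.2 ^^ swap s(u.1, y))
      (side v.1 y v.2 ^^ swap s(v.1, y))
    refine le_trans (le_of_eq ?_) h1
    rw [Set.ncard_eq_toFinset_card', Set.toFinset_ofPred, card_filter]
    push_cast
    refine sum_congr rfl fun i _ => ?_
    congr 1
    simp only [hadj, hy, true_and, eq_iff_iff]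
    cases side u.1 y u.2 <;> cases side y u.1 i <;> cases swap s(u.1, y) <;>
      cases side v.1 y v.2 <;> cases side y v.1 i <;> cases swap s(v.1, y) <;> simp
  · rw [if_neg hy, zero_mul]
    refine le_of_eq (sum_eq_zero fun i _ => if_neg fun h' => hy ⟨?_, ?_⟩)
    · exact ((hadj u (y, i)).1 h'.1).1
    · exact ((hadj v (y, i)).1 h'.2).1

/-- Balancedness, as a bound for a number of neighbours of `x`. -/
lemma IsBipartitionSequence.card_side_eq_le {x : V} {side : V → Fin n → Bool}
    (h : IsBipartitionSequence (fun y : G.neighborSet x => side y) n d α β) {i j : Fin n}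
    (hij : i ≠ j) {_ : DecidablePred fun y => G.Adj x y ∧ side y i = side y j} :
    (#{y | G.Adj x y ∧ side y i = side y j} : ℝ) ≤ (1 / 2 + β) * #{y | G.Adj x y} := by
  have h1 := h.balanced i j hij
  have h2 : d = #{y | G.Adj x y} := by
    rw [← h.card_index, Nat.card_eq_fintype_card, SimpleGraph.card_neighborSet_eq_degree,
      ← SimpleGraph.card_neighborFinset_eq_degree, SimpleGraph.neighborFinset_eq_filter]
  rw [h2] at h1
  refine le_trans (Nat.cast_le.2 ?_) h1
  rw [← Set.ncard_image_of_injective _ Subtype.val_injective, ← Set.ncard_coe_finset]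
  refine Set.ncard_le_ncard ?_ (Set.toFinite _)
  intro y hy
  simp only [coe_filter, mem_univ, true_and, Set.mem_ofPred_eq] at hy
  exact ⟨⟨y, hy.1⟩, hy.2, rfl⟩

/-- The decidability instances are arbitrary, as they depend on the form in which `φ` is given. -/
lemma card_filter_fst (m : ℕ) (φ : V → Prop) {_ : DecidablePred φ}
    {_ : DecidablePred fun w : V × Fin m => φ w.1} :
    (#{w : V × Fin m | φ w.1} : ℝ) = #{y | φ y} * m := by
  rw [card_filter, card_filter, Fintype.sum_prod_type]
  push_cast
  rw [sum_mul]
  refine sum_congr rfl fun y _ => ?_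
  by_cases hy : φ y <;> simp [hy]

end Step

/-- The vertex of `G r` from which a vertex of `G k` stems, for `r ≤ k`. -/
def ancestor {s r : ℕ} {k : ℕ} (h : r ≤ k) : Vertex s k → Vertex s r :=
  Nat.leRec (motive := fun k _ => Vertex s k → Vertex s r) id (fun _ _ f v => f v.1) h

variable {s : ℕ}

lemma ancestor_self {r : ℕ} (v : Vertex s r) : ancestor le_rfl v = v := by
  simp [ancestor]

lemma ancestor_succ {r k : ℕ} (h : r ≤ k) (v : Vertex s (k + 1)) :
    ancestor (h.trans (Nat.le_succ k)) v = ancestor h v.1 := by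
  simp only [ancestor]
  rw [Nat.leRec_succ _ _ h]

lemma fst_ancestor {r k : ℕ} (h : r + 1 ≤ k) (v : Vertex s k) :
    (ancestor h v).1 = ancestor ((Nat.le_succ r).trans h) v := by
  induction k, h using Nat.le_induction with
  | base =>
    rw [ancestor_self, ancestor_succ le_rfl v, ancestor_self]
  | succ k hk ih =>
    rw [ancestor_succ hk v, ih, ← ancestor_succ]

lemma levelSetoid_iff {r k : ℕ} (h : r ≤ k) (a b : Vertex s k) :
    levelSetoid s r k a b ↔ ancestor h a = ancestor h b := by
  induction k with
  | zero =>
    obtain rfl : r = 0 := by omega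
    rw [ancestor_self, ancestor_self]
    rfl
  | succ k ih =>
    by_cases hk : k < r
    · obtain rfl : r = k + 1 := by omega
      rw [ancestor_self, ancestor_self, levelSetoid, if_pos hk]
      rfl
    · have hk' : r ≤ k := by omega
      rw [levelSetoid, if_neg hk, ancestor_succ hk', ancestor_succ hk', ← ih]
      rfl

variable {G : ∀ r, SimpleGraph (Vertex s r)} (hG : IsConstruction s G)

include hG in
/-- A vertex `x` of `G k` has `∏_{r < j ≤ k} n_j / 2` neighbours under each neighbour of its
ancestor in `G r`, and none under other vertices of `G r`. -/
lemma IsConstruction.card_adj_and {r k : ℕ} (h : r ≤ k) (hk : k ≤ s) (x : Vertex s k)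
    (φ : Vertex s r → Prop) :
    (#{v | (G k).Adj x v ∧ φ (ancestor h v)} : ℝ) =
      #{y | (G r).Adj (ancestor h x) y ∧ φ y} * ∏ j ∈ Ioc r k, (blowupSize s j / 2 : ℝ) := by
  induction k, h using Nat.le_induction with
  | base => simp [ancestor_self]
  | succ k hrk ih =>
    rw [prod_Ioc_succ_top (by omega), ← mul_assoc, ancestor_succ hrk x,
      ← ih (by omega) x.1]
    simp only [ancestor_succ hrk]
    exact (hG.succ k hk).card_adj_and x (fun v => φ (ancestor hrk v))

lemma card_filter_ancestor {k : ℕ} (φ : Vertex s 0 → Prop) {_ : DecidablePred φ}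
    {_ : DecidablePred fun v : Vertex s k => φ (ancestor (Nat.zero_le k) v)} :
    (#{v : Vertex s k | φ (ancestor (Nat.zero_le k) v)} : ℝ) =
      #{y | φ y} * ∏ j ∈ Ioc 0 k, (blowupSize s j : ℝ) := by
  induction k with
  | zero =>
    simp only [ancestor_self, Ioc_self, prod_empty, mul_one]
  | succ k ih =>
    rw [prod_Ioc_succ_top (by omega), ← mul_assoc,
      ← @ih (Classical.decPred _)]
    simp only [ancestor_succ (Nat.zero_le k)]
    exact card_filter_fst _ (fun v => φ (ancestor (Nat.zero_le k) v))

lemma card_adj_completeBipartiteGraph (n : ℕ) (x : Fin n ⊕ Fin n)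
    [DecidablePred fun y => (completeBipartiteGraph (Fin n) (Fin n)).Adj x y] :
    #{y | (completeBipartiteGraph (Fin n) (Fin n)).Adj x y} = n := by
  rw [card_filter, Fintype.sum_sum_type]
  rcases x with x | x <;> simp [completeBipartiteGraph]

include hG in
lemma IsConstruction.card_adj_zero (x : Vertex s 0) :
    #{y | (G 0).Adj x y} = blowupSize s 0 := by
  rw [hG.zero]
  exact card_adj_completeBipartiteGraph (blowupSize s 0) x

include hG in
lemma IsConstruction.codegree_le {k : ℕ} (hk : k ≤ s) {x y : Vertex s k}
    (hxy : ancestor (Nat.zero_le k) x ≠ ancestor (Nat.zero_le k) y) :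
    (#{v | (G k).Adj x v ∧ (G k).Adj y v} : ℝ) ≤
      blowupSize s 0 * ∏ j ∈ Ioc 0 k, ((1 / 4 + orth s j) * blowupSize s j) := by
  induction k with
  | zero =>
    simp only [Ioc_self, prod_empty, mul_one]
    rw [← hG.card_adj_zero x]
    exact Nat.cast_le.2 (card_le_card fun v => by simp +contextual)
  | succ k ih =>
    rw [ancestor_succ (Nat.zero_le k), ancestor_succ (Nat.zero_le k)] at hxy
    rw [prod_Ioc_succ_top (by omega), ← mul_assoc]
    have hne : x.1 ≠ y.1 := fun h => hxy (by rw [h])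
    refine ((hG.succ k hk).codegree_le hne).trans ?_
    have : 0 ≤ orth s (k + 1) := by unfold orth; positivity
    exact mul_le_mul_of_nonneg_right (ih (by omega) hxy) (by positivity)

end Levels

/-! ### Numerical estimates -/

section Numerics

open Finset

lemma one_le_blowupSize (s r : ℕ) : 1 ≤ blowupSize s r := by
  cases r <;> exact Nat.one_le_pow _ _ (by norm_num)

lemma density_pos (s : ℕ) : 0 < density s := by unfold density; positivity

lemma density_sq_mul_blowupSize (s : ℕ) : density s ^ 2 * blowupSize s 0 = 4 ^ 8 := by
  have h : ((2 : ℝ) ^ s) ^ 2 = 4 ^ s := by rw [← pow_mul, mul_comm, pow_mul]; norm_num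
  simp only [density, blowupSize, div_pow, h]
  push_cast
  rw [pow_add]
  field_simp

lemma orth_nonneg (s r : ℕ) : 0 ≤ orth s r := by unfold orth; positivity

lemma orth_le {s r : ℕ} (hs : 0 < s) (hr : 0 < r) : orth s r ≤ 1 / (8 * s) := by
  unfold orth
  have h1 : (s : ℝ) ≤ ∏ j ∈ range r, (blowupSize s j : ℝ) := by
    have : s ≤ ∏ j ∈ range r, blowupSize s j := by
      calc s ≤ s + 8 := by omega
        _ ≤ blowupSize s 0 := (Nat.lt_pow_self (by norm_num)).le
        _ ≤ _ := single_le_prod' (f := fun j => blowupSize s j)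
          (fun j _ => one_le_blowupSize s j) (mem_range.2 hr)
    exact_mod_cast this
  have : (0 : ℝ) < s := by exact_mod_cast hs
  gcongr

lemma prod_quarter_add_orth_le {s : ℕ} (hs : 0 < s) :
    ∏ j ∈ Ioc 0 s, (1 / 4 + orth s j) ≤ 2 * (1 / 4 : ℝ) ^ s := by
  have hs' : (0 : ℝ) < s := by exact_mod_cast hs
  calc ∏ j ∈ Ioc 0 s, (1 / 4 + orth s j) ≤ ∏ j ∈ Ioc 0 s, (1 / 4 * Real.exp (1 / (2 * s))) := by
        refine prod_le_prod (fun j _ => add_nonneg (by norm_num) (orth_nonneg s j)) fun j hj => ?_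
        have h1 := orth_le hs (mem_Ioc.1 hj).1
        have h2 := Real.add_one_le_exp (1 / (2 * (s : ℝ)))
        have h3 : 1 / (8 * (s : ℝ)) = 1 / 4 * (1 / (2 * s)) := by field_simp; norm_num
        linarith
    _ = Real.exp (1 / 2) * (1 / 4) ^ s := by
        rw [prod_const, Nat.card_Ioc, Nat.sub_zero, mul_pow, ← Real.exp_nat_mul, mul_comm]
        congr 2
        field_simp
    _ ≤ _ := by
        gcongr
        have h1 := Real.exp_one_lt_d9
        have h2 : Real.exp (1 / 2) ^ 2 = Real.exp 1 := by
          rw [← Real.exp_nat_mul]; norm_num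
        nlinarith [Real.exp_pos (1 / 2)]

lemma density_rpow (s : ℕ) : density s ^ (1 / 7 : ℝ) = (2 : ℝ) ^ (-(s / 7 : ℝ)) := by
  have : density s = (2 : ℝ) ^ (-(s : ℝ)) := by
    rw [Real.rpow_neg (by norm_num), Real.rpow_natCast, density, one_div]
  rw [this, ← Real.rpow_mul (by norm_num)]
  congr 1
  ring

lemma density_eq_rpow (s : ℕ) : density s = (density s ^ (1 / 7 : ℝ)) ^ 7 := by
  rw [← Real.rpow_natCast, ← Real.rpow_mul (density_pos s).le]
  norm_num

lemma density_rpow_le {s : ℕ} (hs : 400 ≤ s) : density s ^ (1 / 7 : ℝ) ≤ 1 / 1024 := by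
  rw [density_rpow]
  have hs' : (400 : ℝ) ≤ s := by exact_mod_cast hs
  calc (2 : ℝ) ^ (-(s / 7 : ℝ)) ≤ (2 : ℝ) ^ (-(10 : ℝ)) :=
        Real.rpow_le_rpow_of_exponent_le (by norm_num) (by linarith)
    _ = 1 / 1024 := by
        rw [Real.rpow_neg (by norm_num)]
        norm_num

lemma four_mul_density_le {s : ℕ} (hs : 400 ≤ s) :
    4 * s * density s ≤ density s ^ (1 / 7 : ℝ) := by
  set q := density s ^ (1 / 7 : ℝ) with hq
  have hq0 : 0 < q := Real.rpow_pos_of_pos (density_pos s) _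
  have hq1 := density_rpow_le hs
  rw [← hq] at hq1
  have hd : density s = q ^ 7 := density_eq_rpow s
  -- `q = 2 ^ (-s / 7)` and `s / 7 ≤ 2 ^ (s / 7)`
  have hsq : (s : ℝ) * q ≤ 7 := by
    have hs' : (400 : ℝ) ≤ s := by exact_mod_cast hs
    have h1 := one_add_mul_self_le_rpow_one_add (s := 1) (by norm_num) (p := (s / 7 : ℝ))
      (by linarith)
    norm_num at h1
    have h2 : q * (2 : ℝ) ^ (s / 7 : ℝ) = 1 := by
      rw [hq, density_rpow, ← Real.rpow_add (by norm_num)]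
      simp
    nlinarith
  have hq5 : q ^ 5 ≤ (1 / 1024) ^ 5 := by gcongr
  calc 4 * s * density s = 4 * (s * q) * q ^ 5 * q := by rw [hd]; ring
    _ ≤ 4 * 7 * (1 / 1024) ^ 5 * q := by gcongr
    _ ≤ q := by nlinarith

end Numerics

/-! ### The construction as a tower -/

section Construction

open Finset
open scoped Classical

variable {s : ℕ} {G : ∀ r, SimpleGraph (Vertex s r)}

lemma IsConstruction.card_blowup_adj_and (hG : IsConstruction s G) (m : ℕ) {r : ℕ} (hr : r ≤ s)
    (a : Vertex s s × Fin m) (φ : Vertex s r → Prop)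
    {_ : DecidablePred fun t : Vertex s s × Fin m => (G s).Adj a.1 t.1 ∧ φ (ancestor hr t.1)} :
    (#{t : Vertex s s × Fin m | (G s).Adj a.1 t.1 ∧ φ (ancestor hr t.1)} : ℝ) =
      #{y | (G r).Adj (ancestor hr a.1) y ∧ φ y} *
        ((∏ j ∈ Ioc r s, (blowupSize s j / 2 : ℝ)) * m) := by
  rw [← mul_assoc, ← hG.card_adj_and hr le_rfl]
  exact card_filter_fst m (fun v => (G s).Adj a.1 v ∧ φ (ancestor hr v))

/-- The blow-up of `G s`, with the partitions into the descendants of vertices of `G r`, is a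
tower. -/
theorem IsConstruction.exists_blowupTower (hG : IsConstruction s G) (hs : 0 < s) (m : ℕ) :
    ∃ T : BlowupTower (Vertex s s × Fin m) s (density s)
      (blowupSize s 0 * (∏ j ∈ Ioc 0 s, (blowupSize s j : ℝ)) * m)
      (blowupSize s 0 * (∏ j ∈ Ioc 0 s, (blowupSize s j / 2 : ℝ)) * m),
      (∀ r, T.cls r = (levelSetoid s r s).comap Prod.fst) ∧
      ∀ a b, T.adj s a b ↔ (blowup (G s) m).Adj a b := by
  choose side swap hseq hadj using hG.succ
  have hcls : ∀ r (hr : r ≤ s) (a b : Vertex s s × Fin m),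
      (levelSetoid s r s).comap Prod.fst a b ↔ ancestor hr a.1 = ancestor hr b.1 :=
    fun r hr a b => levelSetoid_iff hr a.1 b.1
  have hadjs : ∀ a b : Vertex s s × Fin m, (∃ h : s ≤ s,
      (G s).Adj (ancestor h a.1) (ancestor h b.1)) ↔ (G s).Adj a.1 b.1 := fun a b =>
    ⟨fun ⟨_, h⟩ => by simpa only [ancestor_self] using h,
      fun h => ⟨le_rfl, by simpa only [ancestor_self] using h⟩⟩
  have hdeg : ∀ r (hr : r ≤ s) (a : Vertex s s × Fin m),
      (#{y | (G r).Adj (ancestor hr a.1) y} : ℝ) *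
        ((∏ j ∈ Ioc r s, (blowupSize s j / 2 : ℝ)) * m) =
      blowupSize s 0 * (∏ j ∈ Ioc 0 s, (blowupSize s j / 2 : ℝ)) * m := by
    intro r hr a
    have h1 := @IsConstruction.card_blowup_adj_and _ _ hG m _ hr a (fun _ => True)
      (Classical.decPred _)
    have h0 := @IsConstruction.card_blowup_adj_and _ _ hG m _ (Nat.zero_le s) a (fun _ => True)
      (Classical.decPred _)
    simp only [and_true] at h0 h1
    rw [← h1, h0, hG.card_adj_zero, mul_assoc]
  refine ⟨{
    cls := fun r => (levelSetoid s r s).comap Prod.fst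
    adj := fun r a t => ∃ h : r ≤ s, (G r).Adj (ancestor h a.1) (ancestor h t.1)
    side := fun r a t => if h : r < s then
      side r h (ancestor h.le a.1) (ancestor h.le t.1)
        (ancestor (show r + 1 ≤ s from h) a.1).2 else false
    cls_of_succ := ?_
    adj_of_succ := ?_
    not_adj_zero := ?_
    side_congr := ?_
    adj_succ_iff := ?_
    card_univ := ?_
    D_eq := ?_
    card_cls_zero := ?_
    card_adj_zero := ?_
    card_adj := ?_
    card_adj_and := ?_
    card_side_eq := ?_
    codegree := ?_ }, fun _ => rfl, hadjs⟩
  · intro r hr a b h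
    rw [hcls (r + 1) hr] at h
    rw [hcls r hr.le, ← fst_ancestor hr, h, fst_ancestor]
  · rintro r hr a t ⟨_, h⟩
    refine ⟨hr.le, ?_⟩
    have := ((hadj r hr _ _).1 h).1
    rwa [fst_ancestor, fst_ancestor] at this
  · rintro a t h ⟨_, h'⟩
    rw [hcls 0 (Nat.zero_le s)] at h
    rw [h] at h'
    exact (G 0).loopless.irrefl _ h'
  · intro r hr a a' t t' h h'
    rw [hcls (r + 1) hr] at h
    rw [hcls r hr.le] at h'
    have h2 : ancestor hr.le a.1 = ancestor hr.le a'.1 := by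
      rw [← fst_ancestor hr, h, fst_ancestor]
    simp only [dif_pos hr, h, h', h2]
  · rintro r hr a b t h ⟨_, h'⟩
    rw [hcls r hr.le] at h
    simp only [dif_pos hr]
    have ha := (hadj r hr _ _).1 h'
    have hb := hadj r hr (ancestor (show r + 1 ≤ s from hr) b.1)
      (ancestor (show r + 1 ≤ s from hr) t.1)
    simp only [fst_ancestor] at ha hb
    rw [← h] at hb ⊢
    have : (∃ h : r + 1 ≤ s, (G (r + 1)).Adj (ancestor h b.1) (ancestor h t.1)) ↔
        (G (r + 1)).Adj (ancestor (show r + 1 ≤ s from hr) b.1)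
      (ancestor (show r + 1 ≤ s from hr) t.1) := ⟨fun ⟨_, h⟩ => h, fun h => ⟨hr, h⟩⟩
    rw [this, hb, ← ha.2]
    simp only [ha.1, true_and, Bool.xor_left_inj]
    exact eq_comm
  · have h1 := @card_filter_ancestor s s (fun _ => True) (Classical.decPred _)
      (Classical.decPred _)
    simp only [filter_true, Finset.card_univ] at h1
    rw [Fintype.card_prod, Nat.cast_mul, h1, Fintype.card_fin]
    have : Fintype.card (Vertex s 0) = blowupSize s 0 + blowupSize s 0 := by
      change Fintype.card (Fin (blowupSize s 0) ⊕ Fin (blowupSize s 0)) = _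
      simp
    rw [this]
    push_cast
    ring
  · rw [prod_div_distrib, prod_const, Nat.card_Ioc, Nat.sub_zero, density]
    ring
  · intro a
    simp only [hcls 0 (Nat.zero_le s)]
    refine (@card_filter_fst _ _ m
      (fun v => ancestor (Nat.zero_le s) a.1 = ancestor (Nat.zero_le s) v)
      (Classical.decPred _) _).le.trans ?_
    rw [@card_filter_ancestor s s (fun y => ancestor (Nat.zero_le s) a.1 = y)
      (instDecidableEqVertex s 0 _) _, filter_eq, if_pos (mem_univ _), card_singleton]
    have h2 := density_sq_mul_blowupSize s
    have h3 : density s ^ 2 * (blowupSize s 0 * (∏ j ∈ Ioc 0 s, (blowupSize s j : ℝ)) * m) =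
      4 ^ 8 * ((∏ j ∈ Ioc 0 s, (blowupSize s j : ℝ)) * m) := by rw [← h2]; ring
    rw [h3]
    have : (0 : ℝ) ≤ (∏ j ∈ Ioc 0 s, (blowupSize s j : ℝ)) * m := by positivity
    push_cast
    linarith
  · intro a
    simp only [Nat.zero_le, exists_true_left]
    refine (@card_filter_fst _ _ m
      (fun v => (G 0).Adj (ancestor (Nat.zero_le s) a.1) (ancestor (Nat.zero_le s) v))
      (Classical.decPred _) _).le.trans ?_
    rw [@card_filter_ancestor s s (fun y => (G 0).Adj (ancestor (Nat.zero_le s) a.1) y)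
      (Classical.decPred _) _]
    refine le_of_eq (congrArg (fun x : ℕ => (x : ℝ) * _ * _) ?_)
    exact hG.card_adj_zero _
  · intro a
    rw [← hdeg 0 (Nat.zero_le s) a]
    have h0 := @IsConstruction.card_blowup_adj_and _ _ hG m _ (Nat.zero_le s) a (fun _ => True)
      (Classical.decPred _)
    simp only [and_true] at h0
    rw [← h0]
    simp only [hadjs]
  · intro r hr a b h φ hφ
    rw [hcls r hr.le] at h
    -- `φ`, being invariant under `cls r`, descends to a predicate on the vertices of `G r`
    have hφ' : ∀ t, φ t ↔ ∃ w : Vertex s s × Fin m, ancestor hr.le w.1 = ancestor hr.le t.1 ∧ φ w :=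
      fun t => ⟨fun ht => ⟨t, rfl, ht⟩, fun ⟨w, hw, hw'⟩ =>
        (hφ w t ((hcls r hr.le w t).2 hw)).1 hw'⟩
    have ha := @IsConstruction.card_blowup_adj_and _ _ hG m _ hr.le a
      (fun y => ∃ w : Vertex s s × Fin m, ancestor hr.le w.1 = y ∧ φ w) (Classical.decPred _)
    have hb := @IsConstruction.card_blowup_adj_and _ _ hG m _ hr.le b
      (fun y => ∃ w : Vertex s s × Fin m, ancestor hr.le w.1 = y ∧ φ w) (Classical.decPred _)
    rw [h, ← hb] at ha
    simp only [← hφ', Nat.cast_inj] at ha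
    simpa only [hadjs] using ha
  · intro r hr a b h h'
    rw [hcls r hr.le] at h
    rw [hcls (r + 1) hr] at h'
    simp only [hadjs, dif_pos hr, ← h]
    have hne : (ancestor (show r + 1 ≤ s from hr) a.1).2 ≠
        (ancestor (show r + 1 ≤ s from hr) b.1).2 := by
      intro heq
      refine h' (Prod.ext ?_ heq)
      rw [fst_ancestor, fst_ancestor, h]
    have h1 := @IsConstruction.card_blowup_adj_and _ _ hG m _ hr.le a (fun y =>
      side r hr (ancestor hr.le a.1) y (ancestor (show r + 1 ≤ s from hr) a.1).2 =
      side r hr (ancestor hr.le a.1) y (ancestor (show r + 1 ≤ s from hr) b.1).2)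
      (by infer_instance)
    refine (le_of_eq h1).trans ?_
    rw [← hdeg r hr.le a, ← mul_assoc (9 / 16 : ℝ)]
    -- `9 / 16 = 1 / 2 + β` with `β = 1 / 16`
    refine mul_le_mul_of_nonneg_right
      (((hseq r hr (ancestor hr.le a.1)).card_side_eq_le hne).trans_eq ?_) (by positivity)
    norm_num
  · intro a b h
    rw [hcls 0 (Nat.zero_le s)] at h
    simp only [hadjs]
    refine (@card_filter_fst _ _ m (fun v => (G s).Adj a.1 v ∧ (G s).Adj b.1 v)
      (fun _ => instDecidableAnd) _).le.trans ?_
    have h1 := hG.codegree_le le_rfl h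
    have h2 := prod_quarter_add_orth_le hs
    have h3 : (2 : ℝ) * density s * (blowupSize s 0 * (∏ j ∈ Ioc 0 s, (blowupSize s j / 2 : ℝ)) * m)
      = blowupSize s 0 * (2 * (1 / 4) ^ s * ∏ j ∈ Ioc 0 s, (blowupSize s j : ℝ)) * m := by
      rw [prod_div_distrib, prod_const, Nat.card_Ioc, Nat.sub_zero, density,
        show (4 : ℝ) = 2 * 2 by norm_num, div_pow, mul_pow]
      field_simp
      ring
    rw [h3]
    rw [prod_mul_distrib] at h1
    refine mul_le_mul_of_nonneg_right (h1.trans ?_) (by positivity)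
    gcongr

lemma BlowupTower.approxRefines {W : Type*} [Fintype W] [DecidableEq W] {s : ℕ} {p N D : ℝ}
    (T : BlowupTower W s p N D) {R : ℕ} {S : Setoid W} (hS : T.cls R = S) {_ : DecidableRel S.r}
    {γ : ℝ} {Z : Finpartition (univ : Finset W)}
    (h : ∑ P ∈ Z.parts with ¬ T.Concentrated γ R P, (#P : ℝ) ≤ γ * (2 * N)) :
    ApproxRefines γ Z (Finpartition.ofSetoid S) := by
  subst hS
  have key : ∀ P : Finset W, T.Concentrated γ R P ↔
      ApproxMem γ P (Finpartition.ofSetoid (T.cls R)) := by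
    intro P
    have hsd : ∀ y, P \ (Finpartition.ofSetoid (T.cls R)).part y = {u ∈ P | ¬ T.cls R u y} := by
      intro y
      ext u
      rw [mem_sdiff, mem_filter, Finpartition.mem_part_ofSetoid_iff_rel]
      exact and_congr_right fun _ => not_congr ⟨(T.cls R).symm, (T.cls R).symm⟩
    constructor
    · rintro ⟨y, hy⟩
      refine ⟨(Finpartition.ofSetoid (T.cls R)).part y,
        (Finpartition.part_mem _).2 (mem_univ y), ?_⟩
      rw [ApproxSubset, hsd]
      convert hy
    · rintro ⟨Q, hQ, hPQ⟩
      obtain ⟨y, hy⟩ := (Finpartition.ofSetoid (T.cls R)).nonempty_of_mem_parts hQ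
      refine ⟨y, ?_⟩
      rw [ApproxSubset, ← Finpartition.part_eq_of_mem _ hQ hy, hsd] at hPQ
      convert hPQ
  rw [← T.card_univ] at h
  refine le_trans (le_of_eq ?_) h
  refine sum_congr (filter_congr fun P _ => ?_) fun _ _ => rfl
  rw [key]

end Construction

end SRAL

open SRAL
theorem mainTheorem7 (s : ℕ) (hs_even : Even s) (hs : 400 ≤ s)
    (G : ∀ r, SimpleGraph (Vertex s r)) (hG : IsConstruction s G)
    (m : ℕ) (hm : 0 < m)
    (δ : ℝ) (hδ : δ ≤ 1 / 2 ^ 32)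
    (G' : SimpleGraph (Vertex s s × Fin m)) (hclose : IsClose δ (blowup (G s) m) G')
    (Z : Finpartition (Finset.univ : Finset (Vertex s s × Fin m)))
    (hZ : Z ≤ levelPartition s m 0)
    (hreg : IsPerfectlyRegular G' (density s / 16) Z) :
    ApproxRefines (max (64 * √δ) (density s ^ (1 / 7 : ℝ))) Z (levelPartition s m s) := by
  classical
  obtain ⟨T, hcls, hadj⟩ := hG.exists_blowupTower (by omega) m
  set γ := max (64 * √δ) (density s ^ (1 / 7 : ℝ)) with hγ
  set q := density s ^ (1 / 7 : ℝ) with hq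
  have hp := density_pos s
  have hq0 : 0 < q := Real.rpow_pos_of_pos hp _
  have hqγ : q ≤ γ := le_max_right _ _
  have hγ0 : 0 < γ := hq0.trans_le hqγ
  have hN : (0 : ℝ) < blowupSize s 0 * (∏ j ∈ Finset.Ioc 0 s, (blowupSize s j : ℝ)) * m := by
    have : ∀ j, (0 : ℝ) < blowupSize s j := fun j => by exact_mod_cast one_le_blowupSize s j
    have h1 : (0 : ℝ) < m := by exact_mod_cast hm
    have h2 : (0 : ℝ) < ∏ j ∈ Finset.Ioc 0 s, (blowupSize s j : ℝ) :=
      Finset.prod_pos fun j _ => this j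
    exact mul_pos (mul_pos (this 0) h2) h1
  have hq1 : q ≤ 1 / 1024 := density_rpow_le hs
  have hγ1 : γ ≤ 1 / 1024 := by
    refine max_le ?_ hq1
    have : √δ ≤ 1 / 2 ^ 16 := by
      rw [Real.sqrt_le_left (by norm_num)]
      exact hδ.trans (by norm_num)
    linarith
  -- `p = q ^ 7`, so that `γ ≥ q` leaves much room here
  have hpγ : density s ≤ 2 * γ ^ 2 := by
    calc density s = q ^ 5 * q ^ 2 := by rw [← pow_add]; exact density_eq_rpow s
      _ ≤ 1 * γ ^ 2 := by
        gcongr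
        exact pow_le_one₀ hq0.le (hq1.trans (by norm_num))
      _ ≤ _ := by nlinarith [sq_nonneg γ]
  have hδγ : 64 * δ ≤ γ ^ 2 := by
    -- `√δ = 0` for negative `δ`, for which the claim is trivial
    rcases le_or_gt δ 0 with h | h
    · nlinarith [sq_nonneg γ]
    · have h1 : 64 * √δ ≤ γ := le_max_left _ _
      have h2 := Real.sq_sqrt h.le
      have h3 := Real.sqrt_nonneg δ
      nlinarith
  have hZ0 : ∀ P ∈ Z.parts, ∀ a ∈ P, ∀ b ∈ P, T.cls 0 a b := by
    intro P hP a ha b hb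
    obtain ⟨Q, hQ, hPQ⟩ := hZ hP
    rw [hcls]
    unfold levelPartition at hQ
    have := Finpartition.part_eq_of_mem _ hQ (hPQ ha)
    rw [← Finpartition.mem_part_ofSetoid_iff_rel, this]
    exact hPQ hb
  have hmain := T.card_not_concentrated_le hp hN hγ0 hγ1
    ((four_mul_density_le hs).trans hqγ) hpγ hδγ
    (T.sum_edit_le (fun a b => (hadj a b).symm) hclose) hZ0 hreg le_rfl
  unfold levelPartition
  exact T.approxRefines (hcls s) hmain
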